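/- A grand Dyck path of semilength $n$ is a lattice path from $(0,0)$ to $(2n,0)$ with steps $U=(1,1)$ and $D=(1,-1)$. It is symmetric in position $i\in\{1,\dots,n\}$ if its $i$-th step and its $(2n+1-i)$-th step, viewed as segments in the plane, are mirror images of each other under the reflection along the vertical line $x=n$; its degree of symmetry is the number of $i\in\{1,\dots,n\}$ such that it is symmetric in position $i$. Let $X_n$ be the degree of symmetry of a uniformly random grand Dyck path of semilength $n$. Then, as $n\to\infty$, $$\frac{X_n}{\sqrt n}\xrightarrow{d}\mathcal R\!\left(\tfrac1{\sqrt2}\right),$$ where $\mathcal R(\sigma)$ is the Rayleigh distribution, with density $\frac{x}{\sigma^2}e^{-x^2/(2\sigma^2)}$ for $x\ge 0$ (and $0$ for $x<0$); thus $\mathcal R(1/\sqrt2)$ has density $2xe^{-x^2}$ for $x\ge0$. Moreover, $$\mathbb E X_n=\frac{\sqrt{\pi n}}2+O(1),\qquad \mathbb V X_n=\Bigl(1-\frac\pi4\Bigr)n+O(\sqrt n),$$ and $$\Pr(X_n=k)=\frac{2k}{n}e^{-k^2/n}+O\bigl((k+1)n^{-3/2}\bigr)+O(n^{-1})$$ uniformly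 for all integers $k\ge0$; that is, there is an absolute constant $C$ such that, for all $n\ge1$ and $k\ge0$, $$\Bigl|\Pr(X_n=k)-\frac{2k}{n}e^{-k^2/n}\Bigr|\le C\bigl((k+1)n^{-3/2}+n^{-1}\bigr).$$ Finally, for every $n\ge1$, $$\mathbb E X_n=\frac{2^{2n-1}}{\binom{2n}{n}},\qquad \mathbb V X_n=\frac{2n(n-1)}{2n-1}+\frac{2^{2n-1}}{\binom{2n}{n}}-\frac{4^{2n-1}}{\binom{2n}{n}^2}.$$ -/

import Mathlib

open MeasureTheory ProbabilityTheory Filter Asymptotics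

noncomputable section

/-- The two directions of a step: `U = (1, 1)` and `D = (1, -1)`. -/
inductive Step : Type
  | U
  | D
  deriving DecidableEq

instance : Fintype Step where
  elems := {Step.U, Step.D}
  complete := by
    intro s
    cases s <;> simp

/-- The vertical displacement of a step. -/
def Step.rise : Step → ℤ
  | Step.U => 1
  | Step.D => -1

/-- The `y`-coordinate reached after the first `j` steps of the word `w`, starting at height `0`. -/
def wordHeight {m : ℕ} (w : Fin m → Step) (j : ℕ) : ℤ :=
  ∑ i : Fin m with i.val < j, (w i).rise

/-- Grand Dyck paths of semilength `n`: paths with `U` and `D` steps from `(0, 0)` to `(2n, 0)`. -/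
def GrandDyckPath (n : ℕ) : Type :=
  {w : Fin (2 * n) → Step // wordHeight w (2 * n) = 0}

namespace GrandDyckPath

variable {n : ℕ}

instance : Fintype (GrandDyckPath n) :=
  inferInstanceAs (Fintype {w : Fin (2 * n) → Step // wordHeight w (2 * n) = 0})

/-- The vertex of the path `P` on the vertical line `x = j`. -/
def vertex (P : GrandDyckPath n) (j : ℕ) : ℝ × ℝ :=
  ((j : ℝ), (wordHeight P.1 j : ℝ))

/-- The `i`-th step of `P` (for `1 ≤ i ≤ 2n`), as a segment in the plane. -/
def stepSegment (P : GrandDyckPath n) (i : ℕ) : Set (ℝ × ℝ) :=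
  segment ℝ (P.vertex (i - 1)) (P.vertex i)

/-- The reflection of the plane along the vertical line `x = n`. -/
def mirror (n : ℕ) (p : ℝ × ℝ) : ℝ × ℝ :=
  (2 * (n : ℝ) - p.1, p.2)

/-- `P` is symmetric in position `i` (for `1 ≤ i ≤ n`) if its `i`-th step and its `(2n + 1 - i)`-th
step are mirror images of each other with respect to the line `x = n`. -/
def IsSymmetricAt (P : GrandDyckPath n) (i : ℕ) : Prop :=
  mirror n '' P.stepSegment i = P.stepSegment (2 * n + 1 - i)

open Classical in
/-- The degree of symmetry: the number of `i ∈ {1, …, n}` such that `P` is symmetric in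
position `i`. -/
def degSymm (P : GrandDyckPath n) : ℕ :=
  ((Finset.Icc 1 n).filter (fun i => P.IsSymmetricAt i)).card

instance : MeasurableSpace (GrandDyckPath n) := ⊤

instance : MeasurableSingletonClass (GrandDyckPath n) := ⟨fun _ => trivial⟩

instance : Nonempty (GrandDyckPath n) := by
  refine ⟨⟨fun i => if i.val % 2 = 0 then Step.U else Step.D, ?_⟩⟩
  have h : ∀ k : ℕ, (∑ i ∈ Finset.range (2 * k),
      (if i % 2 = 0 then Step.U else Step.D).rise) = 0 := by
    intro k
    induction k with
    | zero => simp
    | succ k ih =>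
      rw [show 2 * (k + 1) = 2 * k + 1 + 1 by ring, Finset.sum_range_succ, Finset.sum_range_succ,
        ih]
      have h2 : (2 * k + 1) % 2 = 1 := by omega
      simp [h2, Step.rise]
  unfold wordHeight
  rw [Finset.filter_true_of_mem (fun i _ => i.isLt)]
  rw [Fin.sum_univ_eq_sum_range (fun i => (if i % 2 = 0 then Step.U else Step.D).rise) (2 * n)]
  exact h n

/-- The uniform probability measure on the grand Dyck paths of semilength `n`. -/
abbrev uniform (n : ℕ) : Measure (GrandDyckPath n) :=
  uniformOn Set.univ

/-- The random variable `X n`: the degree of symmetry of a grand Dyck path of semilength `n`. -/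
def X (n : ℕ) (P : GrandDyckPath n) : ℝ :=
  (P.degSymm : ℝ)

end GrandDyckPath

/-- The density of the Rayleigh distribution with parameter `σ`. -/
def rayleighPDF (σ x : ℝ) : ℝ :=
  if 0 ≤ x then x / σ ^ 2 * Real.exp (-x ^ 2 / (2 * σ ^ 2)) else 0

/-- The Rayleigh distribution with parameter `σ`. -/
def rayleighMeasure (σ : ℝ) : Measure ℝ :=
  volume.withDensity (fun x => ENNReal.ofReal (rayleighPDF σ x))

theorem isProbabilityMeasure_rayleighMeasure {σ : ℝ} (hσ : 0 < σ) :
    IsProbabilityMeasure (rayleighMeasure σ) := by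
  constructor
  have hd : ∀ x : ℝ, HasDerivAt (fun x : ℝ => -Real.exp (-x ^ 2 / (2 * σ ^ 2)))
      (x / σ ^ 2 * Real.exp (-x ^ 2 / (2 * σ ^ 2))) x := by
    intro x
    have h1 : HasDerivAt (fun x : ℝ => -x ^ 2 / (2 * σ ^ 2)) (-(2 * x) / (2 * σ ^ 2)) x := by
      have h2 := ((hasDerivAt_pow 2 x).neg).div_const (2 * σ ^ 2)
      simpa using h2
    have h3 := h1.exp.neg
    refine h3.congr_deriv ?_
    field_simp
  have hlim : Tendsto (fun x : ℝ => -Real.exp (-x ^ 2 / (2 * σ ^ 2))) atTop (nhds 0) := by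
    rw [← neg_zero]
    refine Tendsto.neg (Real.tendsto_exp_atBot.comp ?_)
    refine Tendsto.atBot_div_const (by positivity) ?_
    exact tendsto_neg_atTop_atBot.comp (tendsto_pow_atTop (by norm_num))
  have hpos : ∀ x ∈ Set.Ioi (0 : ℝ), 0 ≤ x / σ ^ 2 * Real.exp (-x ^ 2 / (2 * σ ^ 2)) := by
    intro x hx
    have hx' : (0 : ℝ) < x := hx
    positivity
  have hint := integrableOn_Ioi_deriv_of_nonneg' (fun x _ => hd x) hpos hlim
  have hval := integral_Ioi_of_hasDerivAt_of_nonneg' (fun x _ => hd x) hpos hlim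
  rw [rayleighMeasure, withDensity_apply _ MeasurableSet.univ, Measure.restrict_univ]
  have hfun : (fun x => ENNReal.ofReal (rayleighPDF σ x)) = (Set.Ioi (0 : ℝ)).indicator
      (fun x => ENNReal.ofReal (x / σ ^ 2 * Real.exp (-x ^ 2 / (2 * σ ^ 2)))) := by
    funext x
    rcases lt_trichotomy x 0 with h | h | h
    · simp [rayleighPDF, h.not_ge, h.le]
    · simp [rayleighPDF, h]
    · simp [rayleighPDF, h.le, h]
  rw [hfun, lintegral_indicator measurableSet_Ioi, ← ofReal_integral_eq_lintegral_ofReal hint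
    ((ae_restrict_iff' measurableSet_Ioi).2 (Filter.Eventually.of_forall hpos)), hval]
  simp

instance : IsProbabilityMeasure (rayleighMeasure (1 / Real.sqrt 2)) :=
  isProbabilityMeasure_rayleighMeasure (by positivity)

end

/-!
Pair the `i`-th step of a grand Dyck path with its `i`-th step from the end. Half the difference of
the heights at `x = j` and `x = 2n - j` is then the position after `j` steps of a lazy walk on `ℤ`,
which goes up or down in one way each and stays put in two ways, and which is back at `0` at time
`n`. The path is symmetric in position `i` exactly when the `i`-th step of this walk is flat at
height `0` (`GrandDyckPath.isSymmetricAt_iff`), so the degree of symmetry counts such steps. Sums of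
a function of this count over all walks ending at a given height satisfy a one-step recursion
(`flatSum_succ`), on which everything rests.

*Moments.* The sums of `1`, `k` and `k (k - 1)` have closed forms at every end height (`flatSum_one`,
`flatSum_cast`, `flatSum_mul_sub_one`), checked against the recursion. At height `0` they give the
exact mean and variance, and Wallis' inequalities for the central binomial coefficient give the
asymptotics.

*Local law.* Put `S = √(1 - 4z)` and `t = (1 - S) / (1 + S)`, so that `z = t / (1 + t) ^ 2`. The
walks of length `n` ending at height `h` with `k` flat steps at `0` have the generating function
`t ^ |h| (2z) ^ k / (S + 2z) ^ (k + 1)`. Coefficients are extracted by Cauchy's integral in the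
variable `S`, on a circle through the branch point `S = 0` inside the region where
`ρ = 2z / (S + 2z)` and `t` have modulus at most `1`; the representation follows from the recursion
(`flatSum_eq_contourCoeff`). On this circle `ρ ^ k` and `t ^ k` differ by at most `2 k |S| ^ 2`, and
the kernel `(1 - S ^ 2) ^ (-(n + 1))` is dominated by a Gaussian of width `n ^ (-1/2)`, so replacing
`ρ` by `t` costs no more than the claimed error
(`exists_norm_contourCoeff_flatGF_sub_le`). The coefficient of `t ^ k` is the ballot number
`(k / n) C(2n, n + k)`, whose comparison with the Gaussian is elementary
(`abs_walkCount_ratio_sub_exp_le`).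

*Limit law.* By the local law the density `√n P(X_n = ⌊x √n⌋)` converges pointwise to the Rayleigh
density. Fatou's lemma gives `liminf P(X_n / √n ∈ G) ≥ R(G)` for the limit law `R` and every open
`G`, which suffices by the portmanteau theorem.
-/

/-! ### Folding a word at its middle -/

/-- Half the total rise of a pair of steps. -/
def foldStep : Step × Step → ℤ
  | (Step.U, Step.U) => 1
  | (Step.D, Step.D) => -1
  | _ => 0

theorem two_mul_foldStep (s : Step × Step) : 2 * foldStep s = s.1.rise + s.2.rise := by
  obtain ⟨a, b⟩ := s
  cases a <;> cases b <;> rfl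

/-- The height after `j` steps of the lazy walk whose increments are the half rises of the pairs
`v 0, v 1, …`. -/
def foldHeight {m : ℕ} (v : Fin m → Step × Step) (j : ℕ) : ℤ :=
  ∑ i : Fin m with i.val < j, foldStep (v i)

/-- The number of steps of the lazy walk that stay at height `0`. -/
def flats {m : ℕ} (v : Fin m → Step × Step) : ℕ :=
  ((Finset.range m).filter (fun j => foldHeight v j = 0 ∧ foldHeight v (j + 1) = 0)).card

theorem sum_filter_val_lt_succ {m : ℕ} (f : Fin m → ℤ) {j : ℕ} (hj : j < m) :
    ∑ i : Fin m with i.val < j + 1, f i = ∑ i : Fin m with i.val < j, f i + f ⟨j, hj⟩ := by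
  have : (Finset.univ.filter fun i : Fin m => i.val < j + 1) =
      insert ⟨j, hj⟩ (Finset.univ.filter fun i : Fin m => i.val < j) := by
    ext i
    simp only [Finset.mem_filter, Finset.mem_univ, true_and, Finset.mem_insert, Fin.ext_iff]
    omega
  rw [this, Finset.sum_insert (by simp), add_comm]

theorem wordHeight_succ {m : ℕ} (w : Fin m → Step) {j : ℕ} (hj : j < m) :
    wordHeight w (j + 1) = wordHeight w j + (w ⟨j, hj⟩).rise :=
  sum_filter_val_lt_succ _ hj

theorem foldHeight_succ {m : ℕ} (v : Fin m → Step × Step) {j : ℕ} (hj : j < m) :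
    foldHeight v (j + 1) = foldHeight v j + foldStep (v ⟨j, hj⟩) :=
  sum_filter_val_lt_succ _ hj

/-- Words of length `2n` are words of length `n` in pairs of steps: the `i`-th step is paired with
the `i`-th step from the end. -/
def foldEquiv (n : ℕ) : (Fin (2 * n) → Step) ≃ (Fin n → Step × Step) where
  toFun w i := (w ⟨i, by omega⟩, w ⟨2 * n - 1 - i, by omega⟩)
  invFun v i := if h : i.val < n then (v ⟨i, h⟩).1 else (v ⟨2 * n - 1 - i, by omega⟩).2
  left_inv w := by
    funext i
    by_cases h : i.val < n
    · simp [h]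
    · simp only [h, dite_false]
      congr 1
      ext
      simp only
      omega
  right_inv v := by
    funext i
    have h : ¬ 2 * n - 1 - i.val < n := by omega
    have h2 : 2 * n - 1 - (2 * n - 1 - i.val) = i.val := by omega
    simp [h, h2]

/-- The lazy walk is half the difference of the heights at mirror-image abscissae; the term
`wordHeight w (2 * n)` vanishes for a grand Dyck path. -/
theorem two_mul_foldHeight {n : ℕ} (w : Fin (2 * n) → Step) {j : ℕ} (hj : j ≤ n) :
    2 * foldHeight (foldEquiv n w) j
      = wordHeight w (2 * n) - wordHeight w (2 * n - j) + wordHeight w j := by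
  induction j with
  | zero => simp [foldHeight, wordHeight]
  | succ j ih =>
    have ih := ih (by omega)
    have h1 := wordHeight_succ w (j := j) (by omega)
    have h2 := wordHeight_succ w (j := 2 * n - 1 - j) (by omega)
    have h3 : 2 * n - 1 - j + 1 = 2 * n - j := by omega
    have h4 : 2 * n - (j + 1) = 2 * n - 1 - j := by omega
    rw [h3] at h2
    rw [foldHeight_succ _ (by omega : j < n), mul_add, two_mul_foldStep, ih, h1, h4, h2]
    simp only [foldEquiv, Equiv.coe_fn_mk]
    ring

theorem foldHeight_foldEquiv_eq_zero_iff {n : ℕ} (w : Fin (2 * n) → Step) :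
    foldHeight (foldEquiv n w) n = 0 ↔ wordHeight w (2 * n) = 0 := by
  have h := two_mul_foldHeight w le_rfl
  rw [show 2 * n - n = n by omega] at h
  omega

namespace GrandDyckPath

variable {n : ℕ}

theorem foldHeight_eq_zero_iff (P : GrandDyckPath n) {j : ℕ} (hj : j ≤ n) :
    foldHeight (foldEquiv n P.1) j = 0 ↔ wordHeight P.1 j = wordHeight P.1 (2 * n - j) := by
  have h := two_mul_foldHeight P.1 hj
  have h0 := P.2
  omega

theorem mirror_image_segment (x y : ℝ × ℝ) :
    mirror n '' segment ℝ x y = segment ℝ (mirror n x) (mirror n y) := by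
  let f : ℝ × ℝ →ᵃ[ℝ] ℝ × ℝ :=
    { toFun := mirror n
      linear := (-LinearMap.fst ℝ ℝ ℝ).prod (LinearMap.snd ℝ ℝ ℝ)
      map_vadd' := fun p v => by
        ext
        · change 2 * (n : ℝ) - (v.1 + p.1) = -v.1 + (2 * (n : ℝ) - p.1)
          ring
        · rfl }
  exact image_segment ℝ f x y

/-- A point of a segment with distinct abscissae that lies above the right end is the right end. -/
theorem snd_eq_of_mem_segment {x y p : ℝ × ℝ} (hp : p ∈ segment ℝ x y) (hxy : x.1 ≠ y.1)
    (h : p.1 = y.1) : p.2 = y.2 := by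
  obtain ⟨a, b, -, -, hab, rfl⟩ := hp
  simp only [Prod.fst_add, Prod.smul_fst, smul_eq_mul, Prod.snd_add, Prod.smul_snd] at h ⊢
  have hb : b = 1 - a := by linarith
  subst hb
  have : a * (x.1 - y.1) = 0 := by linarith
  rcases mul_eq_zero.1 this with h | h
  · simp [h]
  · exact absurd (by linarith) hxy

/-- Mirror-image segments have equal heights at both pairs of end points. -/
theorem isSymmetricAt_iff (P : GrandDyckPath n) {i : ℕ} (hi : i < n) :
    P.IsSymmetricAt (i + 1) ↔
      foldHeight (foldEquiv n P.1) i = 0 ∧ foldHeight (foldEquiv n P.1) (i + 1) = 0 := by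
  rw [P.foldHeight_eq_zero_iff hi.le, P.foldHeight_eq_zero_iff (by omega : i + 1 ≤ n)]
  have e1 : 2 * n + 1 - (i + 1) = 2 * n - i := by omega
  have e2 : 2 * n - i - 1 = 2 * n - (i + 1) := by omega
  unfold IsSymmetricAt stepSegment
  rw [mirror_image_segment, e1, e2, Nat.add_sub_cancel]
  have c1 : ((2 * n - i : ℕ) : ℝ) = 2 * n - i := by
    rw [Nat.cast_sub (by omega)]; push_cast; ring
  have c2 : ((2 * n - (i + 1) : ℕ) : ℝ) = 2 * n - (i + 1) := by
    rw [Nat.cast_sub (by omega)]; push_cast; ring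
  constructor
  · intro h
    have m1 := left_mem_segment ℝ (mirror n (P.vertex i)) (mirror n (P.vertex (i + 1)))
    have m2 := right_mem_segment ℝ (mirror n (P.vertex i)) (mirror n (P.vertex (i + 1)))
    rw [h] at m1 m2
    rw [segment_symm] at m2
    have r1 := snd_eq_of_mem_segment m1 (by simp [vertex, c1, c2])
      (by simp [vertex, mirror, c1])
    have r2 := snd_eq_of_mem_segment m2 (by simp [vertex, c1, c2])
      (by simp [vertex, mirror, c2])
    simp only [vertex, mirror, Int.cast_inj] at r1 r2
    exact ⟨r1, r2⟩
  · rintro ⟨h1, h2⟩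
    have v1 : mirror n (P.vertex i) = P.vertex (2 * n - i) := by
      simp [vertex, mirror, c1, h1]
    have v2 : mirror n (P.vertex (i + 1)) = P.vertex (2 * n - (i + 1)) := by
      simp [vertex, mirror, c2, h2]
    rw [v1, v2, segment_symm]

theorem degSymm_eq_flats (P : GrandDyckPath n) : P.degSymm = flats (foldEquiv n P.1) := by
  classical
  unfold degSymm flats
  symm
  refine Finset.card_bij (fun j _ => j + 1) ?_ ?_ ?_
  · intro j hj
    rw [Finset.mem_filter, Finset.mem_range] at hj
    rw [Finset.mem_filter, Finset.mem_Icc, P.isSymmetricAt_iff hj.1]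
    exact ⟨by omega, hj.2⟩
  · intro a _ b _ h
    omega
  · intro i hi
    rw [Finset.mem_filter, Finset.mem_Icc] at hi
    obtain ⟨⟨h1, h2⟩, h3⟩ := hi
    obtain ⟨j, rfl⟩ := Nat.exists_eq_add_of_le' h1
    rw [P.isSymmetricAt_iff (by omega)] at h3
    exact ⟨j, by rw [Finset.mem_filter, Finset.mem_range]; exact ⟨by omega, h3⟩, rfl⟩

end GrandDyckPath

/-! ### Step-by-step recursion for the lazy walk -/

/-- The sum of `f` of the number of flat steps at height `0`, over the lazy walks of length `n`
that end at height `h`. -/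
def flatSum {R : Type*} [CommSemiring R] (n : ℕ) (h : ℤ) (f : ℕ → R) : R :=
  ∑ v : Fin n → Step × Step, if foldHeight v n = h then f (flats v) else 0

theorem foldHeight_snoc {m : ℕ} (v : Fin m → Step × Step) (s : Step × Step) {j : ℕ} (hj : j ≤ m) :
    foldHeight (Fin.snoc v s : Fin (m + 1) → Step × Step) j = foldHeight v j := by
  induction j with
  | zero => simp [foldHeight]
  | succ j ih =>
    rw [foldHeight_succ _ (by omega : j < m + 1), foldHeight_succ _ (by omega : j < m),
      ih (by omega)]
    congr 2
    exact Fin.snoc_castSucc (α := fun _ => Step × Step) s v ⟨j, by omega⟩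

theorem foldHeight_snoc_last {m : ℕ} (v : Fin m → Step × Step) (s : Step × Step) :
    foldHeight (Fin.snoc v s : Fin (m + 1) → Step × Step) (m + 1)
      = foldHeight v m + foldStep s := by
  rw [foldHeight_succ _ (by omega : m < m + 1), foldHeight_snoc _ _ le_rfl]
  congr 2
  exact Fin.snoc_last (α := fun _ => Step × Step) s v

theorem flats_snoc {m : ℕ} (v : Fin m → Step × Step) (s : Step × Step) :
    flats (Fin.snoc v s : Fin (m + 1) → Step × Step)
      = flats v + if foldHeight v m = 0 ∧ foldStep s = 0 then 1 else 0 := by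
  unfold flats
  rw [Finset.card_filter, Finset.card_filter, Finset.sum_range_succ, foldHeight_snoc_last,
    foldHeight_snoc _ _ le_rfl]
  congr 1
  · refine Finset.sum_congr rfl fun j hj => ?_
    rw [Finset.mem_range] at hj
    rw [foldHeight_snoc _ _ hj.le, foldHeight_snoc _ _ (by omega : j + 1 ≤ m)]
  · refine if_congr ?_ rfl rfl
    constructor <;> rintro ⟨h1, h2⟩ <;> exact ⟨h1, by omega⟩

theorem flatSum_zero {R : Type*} [CommSemiring R] (h : ℤ) (f : ℕ → R) :
    flatSum 0 h f = if h = 0 then f 0 else 0 := by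
  simp [flatSum, foldHeight, flats, eq_comm]

/-- Removal of the last step. The step is flat in two ways, and a flat step counts only if it is at
height `0`. -/
theorem flatSum_succ {R : Type*} [CommSemiring R] (n : ℕ) (h : ℤ) (f : ℕ → R) :
    flatSum (n + 1) h f = 2 * flatSum n h (fun k => f (k + if h = 0 then 1 else 0))
      + flatSum n (h - 1) f + flatSum n (h + 1) f := by
  have huniv : (Finset.univ : Finset (Step × Step))
      = {(Step.U, Step.U), (Step.U, Step.D), (Step.D, Step.U), (Step.D, Step.D)} := rfl
  unfold flatSum
  rw [← (Fin.snocEquiv (fun _ => Step × Step)).sum_comp, Fintype.sum_prod_type]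
  have e (s : Step × Step) : ∑ v : Fin n → Step × Step,
      (if foldHeight (Fin.snoc v s : Fin (n + 1) → Step × Step) (n + 1) = h
        then f (flats (Fin.snoc v s : Fin (n + 1) → Step × Step)) else 0)
      = ∑ v : Fin n → Step × Step, if foldHeight v n = h - foldStep s
        then f (flats v + if h = 0 ∧ foldStep s = 0 then 1 else 0) else 0 := by
    refine Finset.sum_congr rfl fun v _ => ?_
    rw [foldHeight_snoc_last, flats_snoc]
    by_cases h1 : foldHeight v n = h - foldStep s
    · rw [if_pos (by omega), if_pos h1]
      congr 2
      refine if_congr ?_ rfl rfl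
      constructor <;> rintro ⟨h2, h3⟩ <;> exact ⟨by omega, h3⟩
    · rw [if_neg (by omega), if_neg h1]
  refine (Fintype.sum_congr _ _ e).trans ?_
  rw [huniv]
  simp [foldStep]
  ring

theorem eq_zero_or_exists_eq_succ (m : ℕ) : m = 0 ∨ ∃ k, m = k + 1 := by
  cases m <;> simp

theorem flatSum_add {R : Type*} [CommSemiring R] (n : ℕ) (h : ℤ) (f g : ℕ → R) :
    flatSum n h (fun k => f k + g k) = flatSum n h f + flatSum n h g := by
  unfold flatSum
  rw [← Finset.sum_add_distrib]
  refine Finset.sum_congr rfl fun v _ => ?_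
  split_ifs <;> simp

theorem flatSum_const_mul {R : Type*} [CommSemiring R] (n : ℕ) (h : ℤ) (c : R) (f : ℕ → R) :
    flatSum n h (fun k => c * f k) = c * flatSum n h f := by
  unfold flatSum
  rw [Finset.mul_sum]
  refine Finset.sum_congr rfl fun v _ => ?_
  split_ifs <;> simp

theorem flatSum_succ_of_ne_zero {R : Type*} [CommSemiring R] {n : ℕ} {f : ℕ → R} {F : ℕ → R}
    (hF : ∀ h : ℤ, flatSum n h f = F h.natAbs) {h : ℤ} {m : ℕ} (hm : h.natAbs = m + 1) :
    flatSum (n + 1) h f = 2 * F (m + 1) + F m + F (m + 2) := by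
  have h0 : h ≠ 0 := by rintro rfl; simp at hm
  rw [flatSum_succ]
  simp only [h0, if_false, add_zero, hF, hm]
  rcases lt_or_gt_of_ne h0 with h1 | h1
  · rw [show (h - 1).natAbs = m + 2 by omega, show (h + 1).natAbs = m by omega]
    ring
  · rw [show (h - 1).natAbs = m by omega, show (h + 1).natAbs = m + 2 by omega]

theorem flatSum_succ_at_zero {R : Type*} [CommSemiring R] {n : ℕ} {f : ℕ → R} {F : ℕ → R}
    (hF : ∀ h : ℤ, flatSum n h f = F h.natAbs) :
    flatSum (n + 1) 0 f = 2 * flatSum n 0 (fun k => f (k + 1)) + 2 * F 1 := by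
  rw [flatSum_succ]
  simp [hF]
  ring

/-! ### Exact factorial moments -/

/-- The number of lazy walks of length `n` ending at height `h`. -/
def walkCount (n h : ℕ) : ℝ :=
  ((2 * n).choose (n + h) : ℝ)

theorem walkCount_succ_succ (n h : ℕ) :
    walkCount (n + 1) (h + 1)
      = 2 * walkCount n (h + 1) + walkCount n h + walkCount n (h + 2) := by
  unfold walkCount
  rw [show 2 * (n + 1) = 2 * n + 1 + 1 by ring, show n + 1 + (h + 1) = n + h + 1 + 1 by ring,
    Nat.choose_succ_succ', Nat.choose_succ_succ', Nat.choose_succ_succ' (2 * n) (n + h + 1)]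
  push_cast
  rw [show n + (h + 1) = n + h + 1 by ring, show n + (h + 2) = n + h + 1 + 1 by ring]
  ring

theorem walkCount_succ_zero (n : ℕ) :
    walkCount (n + 1) 0 = 2 * walkCount n 0 + 2 * walkCount n 1 := by
  unfold walkCount
  rw [show 2 * (n + 1) = 2 * n + 1 + 1 by ring, add_zero, add_zero, Nat.choose_succ_succ',
    ← Nat.choose_symm_half n, Nat.choose_succ_succ' (2 * n) n]
  push_cast
  ring

theorem walkCount_zero_succ (h : ℕ) : walkCount 0 (h + 1) = 0 := by
  simp [walkCount]

theorem walkCount_zero_zero : walkCount 0 0 = 1 := by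
  simp [walkCount]

theorem walkCount_zero_pos (n : ℕ) : 0 < walkCount n 0 := by
  unfold walkCount
  exact_mod_cast Nat.choose_pos (by omega)

theorem flatSum_one (n : ℕ) (h : ℤ) :
    flatSum n h (fun _ => (1 : ℝ)) = walkCount n h.natAbs := by
  induction n generalizing h with
  | zero =>
    rw [flatSum_zero]
    rcases eq_zero_or_exists_eq_succ h.natAbs with h0 | ⟨m, h0⟩
    · rw [h0, walkCount_zero_zero, if_pos (by omega)]
    · rw [h0, walkCount_zero_succ, if_neg (by omega)]
  | succ n ih =>
    rcases eq_zero_or_exists_eq_succ h.natAbs with h0 | ⟨m, h0⟩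
    · obtain rfl : h = 0 := by omega
      rw [flatSum_succ_at_zero ih, ih, Int.natAbs_zero, walkCount_succ_zero]
    · rw [flatSum_succ_of_ne_zero ih h0, h0]
      exact (walkCount_succ_succ n _).symm

/-- The binomial tail `C(2n, n+h) + 2 ∑_{j > h} C(2n, n+j)`, written as a complement in `4 ^ n`.
It is the coefficient of `z ^ n` in `t ^ h / (1 - 4z)`, where `z = t / (1 + t) ^ 2`. -/
def walkTail (n h : ℕ) : ℝ :=
  4 ^ n - ∑ j ∈ Finset.range h, (walkCount n j + walkCount n (j + 1))

theorem walkTail_zero (n : ℕ) : walkTail n 0 = 4 ^ n := by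
  simp [walkTail]

theorem walkTail_succ (n h : ℕ) :
    walkTail n (h + 1) = walkTail n h - (walkCount n h + walkCount n (h + 1)) := by
  simp only [walkTail, Finset.sum_range_succ]
  ring

theorem walkTail_zero_succ (h : ℕ) : walkTail 0 (h + 1) = 0 := by
  induction h with
  | zero => simp [walkTail_succ, walkTail_zero, walkCount_zero_zero, walkCount_zero_succ]
  | succ h ih => rw [walkTail_succ, ih, walkCount_zero_succ, walkCount_zero_succ]; simp

theorem walkTail_succ_succ (n h : ℕ) :
    walkTail (n + 1) (h + 1) = 2 * walkTail n (h + 1) + walkTail n h + walkTail n (h + 2) := by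
  induction h with
  | zero =>
    simp only [walkTail_succ, walkTail_zero, walkCount_succ_zero, walkCount_succ_succ]
    ring
  | succ h ih =>
    rw [walkTail_succ, ih, walkCount_succ_succ, walkCount_succ_succ, walkTail_succ n (h + 2),
      walkTail_succ n (h + 1), walkTail_succ n h]
    ring

theorem flatSum_one_length {f : ℕ → ℝ} (hf : f 0 = 0) (h : ℤ) :
    flatSum 1 h f = if h = 0 then 2 * f 1 else 0 := by
  refine (flatSum_succ 0 h f).trans ?_
  simp only [flatSum_zero, hf, ite_self, add_zero]
  split_ifs <;> simp

/-- The first moment of the number of flat steps, at every end height. -/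
theorem flatSum_cast (n : ℕ) (h : ℤ) :
    flatSum (n + 1) h (fun k => (k : ℝ)) = 2 * walkTail n h.natAbs := by
  induction n generalizing h with
  | zero =>
    rw [zero_add, flatSum_one_length (by simp)]
    rcases eq_zero_or_exists_eq_succ h.natAbs with h0 | ⟨m, h0⟩
    · rw [h0, walkTail_zero, if_pos (by omega)]
      simp
    · rw [h0, walkTail_zero_succ, if_neg (by omega)]
      simp
  | succ n ih =>
    rcases eq_zero_or_exists_eq_succ h.natAbs with h0 | ⟨m, h0⟩
    · obtain rfl : h = 0 := by omega
      rw [flatSum_succ_at_zero (F := fun h => 2 * walkTail n h) ih]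
      push_cast
      rw [flatSum_add, ih, flatSum_one]
      simp only [Int.natAbs_zero, walkTail_succ, walkTail_zero, walkCount_succ_zero]
      ring
    · rw [flatSum_succ_of_ne_zero (F := fun h => 2 * walkTail n h) ih h0, h0]
      rw [walkTail_succ_succ n m]
      ring

/-- The second factorial moment of the number of flat steps, at every end height. With
`z = t / (1 + t) ^ 2` and `S = √(1 - 4z)` the generating function is `8 z ^ 2 t ^ |h| / S ^ 3`, which
is `4 z` times the difference of `z d/dz (t ^ |h| / S)` and `|h| t ^ |h| / S ^ 2`. -/
theorem flatSum_mul_sub_one (n : ℕ) (h : ℤ) :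
    flatSum (n + 1) h (fun k => (k : ℝ) * (k - 1))
      = 4 * (n * walkCount n h.natAbs - h.natAbs * walkTail n h.natAbs) := by
  induction n generalizing h with
  | zero =>
    rw [zero_add, flatSum_one_length (by simp)]
    rcases eq_zero_or_exists_eq_succ h.natAbs with h0 | ⟨m, h0⟩
    · rw [h0, if_pos (by omega)]
      simp
    · rw [h0, walkTail_zero_succ, if_neg (by omega)]
      simp
  | succ n ih =>
    rcases eq_zero_or_exists_eq_succ h.natAbs with h0 | ⟨m, h0⟩
    · obtain rfl : h = 0 := by omega
      rw [flatSum_succ_at_zero (F := fun h : ℕ => 4 * (n * walkCount n h - h * walkTail n h)) ih]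
      have e : (fun k : ℕ => ((k + 1 : ℕ) : ℝ) * ((k + 1 : ℕ) - 1))
          = fun k : ℕ => (k : ℝ) * (k - 1) + 2 * k := by
        funext k
        push_cast
        ring
      rw [e, flatSum_add, flatSum_const_mul, ih, flatSum_cast]
      simp only [Int.natAbs_zero, walkTail_succ, walkTail_zero, walkCount_succ_zero]
      push_cast
      ring
    · rw [flatSum_succ_of_ne_zero
        (F := fun h : ℕ => 4 * (n * walkCount n h - h * walkTail n h)) ih h0, h0]
      have e1 := walkTail_succ_succ n m
      have e2 := walkCount_succ_succ n m
      have e3 := walkTail_succ n m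
      have e4 := walkTail_succ n (m + 1)
      rw [e1, e2, e4, e3]
      push_cast
      ring

/-! ### Expectations under the uniform measure -/

theorem sum_grandDyckPath {R : Type*} [CommSemiring R] (n : ℕ) (f : ℕ → R) :
    ∑ P : GrandDyckPath n, f P.degSymm = flatSum n 0 f := by
  unfold flatSum
  rw [← Finset.sum_filter]
  refine Finset.sum_bij (fun P _ => foldEquiv n P.1) ?_ ?_ ?_ ?_
  · intro P _
    simpa using (foldHeight_foldEquiv_eq_zero_iff P.1).2 P.2
  · intro P _ Q _ h
    exact Subtype.ext ((foldEquiv n).injective h)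
  · intro v hv
    rw [Finset.mem_filter] at hv
    refine ⟨⟨(foldEquiv n).symm v, ?_⟩, Finset.mem_univ _, by simp⟩
    rw [← foldHeight_foldEquiv_eq_zero_iff]
    simpa using hv.2
  · intro P _
    rw [P.degSymm_eq_flats]

namespace GrandDyckPath

theorem card_eq (n : ℕ) : (Fintype.card (GrandDyckPath n) : ℝ) = walkCount n 0 := by
  have h := sum_grandDyckPath n (fun _ => (1 : ℝ))
  rw [flatSum_one] at h
  simpa using h

theorem integral_uniform (n : ℕ) (f : ℕ → ℝ) :
    ∫ P, f P.degSymm ∂(uniform n) = flatSum n 0 f / walkCount n 0 := by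
  rw [← sum_grandDyckPath, ← card_eq, integral_fintype (Integrable.of_finite), Finset.sum_div]
  refine Finset.sum_congr rfl fun P _ => ?_
  have : (uniform n).real {P} = (Fintype.card (GrandDyckPath n) : ℝ)⁻¹ := by
    rw [measureReal_def, uniform, uniformOn_univ, Measure.count_singleton]
    simp
  rw [this, smul_eq_mul]
  ring

theorem uniform_real_degSymm (n k : ℕ) :
    (uniform n).real {P | P.degSymm = k}
      = flatSum n 0 (fun j => if j = k then 1 else 0) / walkCount n 0 := by
  rw [← integral_uniform, ← integral_indicator_one (MeasurableSpace.measurableSet_top)]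
  refine integral_congr_ae (Eventually.of_forall fun P => ?_)
  simp [Set.indicator_apply]

theorem integral_X (n : ℕ) :
    ∫ P, X (n + 1) P ∂(uniform (n + 1)) = 2 * 4 ^ n / walkCount (n + 1) 0 := by
  unfold X
  rw [integral_uniform (n + 1) (fun k => (k : ℝ)), flatSum_cast, Int.natAbs_zero, walkTail_zero]

theorem walkCount_succ_zero_mul (n : ℕ) :
    (n + 1) * walkCount (n + 1) 0 = 2 * (2 * n + 1) * walkCount n 0 := by
  have h := Nat.succ_mul_centralBinom_succ n
  rw [Nat.centralBinom, Nat.centralBinom] at h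
  unfold walkCount
  exact_mod_cast h

theorem variance_X (n : ℕ) :
    variance (X (n + 1)) (uniform (n + 1))
      = 2 * (n + 1) * n / (2 * n + 1) + 2 * 4 ^ n / walkCount (n + 1) 0
        - (2 * 4 ^ n / walkCount (n + 1) 0) ^ 2 := by
  have hX : MemLp (X (n + 1)) 2 (uniform (n + 1)) := MemLp.of_discrete
  rw [variance_eq_sub hX, integral_X]
  congr 1
  have e : (X (n + 1) ^ 2 : GrandDyckPath (n + 1) → ℝ)
      = fun P => (fun k : ℕ => (k : ℝ) * (k - 1) + k) P.degSymm := by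
    funext P
    simp only [Pi.pow_apply, X]
    ring
  rw [e, integral_uniform, flatSum_add, flatSum_mul_sub_one, flatSum_cast, add_div, Int.natAbs_zero,
    walkTail_zero]
  congr 1
  have h := walkCount_succ_zero_mul n
  have h1 := walkCount_zero_pos (n + 1)
  have h2 : (0 : ℝ) < 2 * n + 1 := by positivity
  rw [div_eq_div_iff h1.ne' h2.ne']
  linear_combination (-2 * (n : ℝ)) * h

end GrandDyckPath

/-! ### Coefficient extraction by a contour integral -/

/-- The coefficient of `z ^ n` of a function given in the variable `S = √(1 - 4z)`. The Cauchy
integral around `z = 0` becomes, through `z = (1 - S ^ 2) / 4`, an integral around `S = 1`; the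
contour is the circle with diameter `[0, 3/2]`, which touches the image `Re S = 0` of the cut
`[1/4, ∞)` at the branch point only. -/
noncomputable def contourCoeff (n : ℕ) (F : ℂ → ℂ) : ℂ :=
  -(4 ^ n * (2 * Real.pi * Complex.I)⁻¹ *
    ∮ S in C(3 / 4, 3 / 4), 2 * S * F S * ((1 - S ^ 2) ^ (n + 1))⁻¹)

theorem normSq_le_of_mem_closedBall {S : ℂ} (hS : S ∈ Metric.closedBall (3 / 4 : ℂ) (3 / 4)) :
    S.re ^ 2 + S.im ^ 2 ≤ 3 / 2 * S.re := by
  rw [mem_closedBall_iff_norm] at hS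
  have h1 : ‖S - 3 / 4‖ ^ 2 ≤ (3 / 4) ^ 2 := by gcongr
  rw [← Complex.normSq_eq_norm_sq, Complex.normSq_apply] at h1
  simp at h1
  linarith

theorem normSq_eq_of_mem_sphere {S : ℂ} (hS : S ∈ Metric.sphere (3 / 4 : ℂ) (3 / 4)) :
    S.re ^ 2 + S.im ^ 2 = 3 / 2 * S.re := by
  rw [mem_sphere_iff_norm] at hS
  have h1 : ‖S - 3 / 4‖ ^ 2 = (3 / 4) ^ 2 := by rw [hS]
  rw [← Complex.normSq_eq_norm_sq, Complex.normSq_apply] at h1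
  simp at h1
  linarith

theorem re_mem_of_mem_closedBall {S : ℂ} (hS : S ∈ Metric.closedBall (3 / 4 : ℂ) (3 / 4)) :
    0 ≤ S.re ∧ S.re ≤ 3 / 2 := by
  have h := normSq_le_of_mem_closedBall hS
  constructor <;> nlinarith [sq_nonneg S.re, sq_nonneg S.im]

theorem one_add_ne_zero_of_re_nonneg {S : ℂ} (hS : 0 ≤ S.re) : 1 + S ≠ 0 := by
  intro h
  have := congrArg Complex.re h
  simp at this
  linarith

theorem one_sub_sq_ne_zero {S : ℂ} (hS : S ∈ Metric.sphere (3 / 4 : ℂ) (3 / 4)) :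
    1 - S ^ 2 ≠ 0 := by
  have h1 := one_add_ne_zero_of_re_nonneg
    (re_mem_of_mem_closedBall (Metric.sphere_subset_closedBall hS)).1
  have h2 : 1 - S ≠ 0 := by
    intro h
    have h3 : S = 1 := (sub_eq_zero.1 h).symm
    have := normSq_eq_of_mem_sphere hS
    rw [h3] at this
    norm_num at this
  rw [show 1 - S ^ 2 = (1 - S) * (1 + S) by ring]
  exact mul_ne_zero h2 h1

/-- The identity behind `|(1 - S ^ 2) / (1 + 2 S - S ^ 2)| ≤ 1` on the disc. -/
theorem normSq_one_add_two_mul_sub_sq_sub (S : ℂ) :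
    Complex.normSq (1 + 2 * S - S ^ 2) - Complex.normSq (1 - S ^ 2)
      = 4 * (S.re ^ 2 + S.im ^ 2 + S.re - (S.re ^ 2 + S.im ^ 2) * S.re) := by
  simp [Complex.normSq_apply, pow_two]
  ring

theorem re_div_four_le {S : ℂ} (hS : S ∈ Metric.closedBall (3 / 4 : ℂ) (3 / 4)) :
    S.re / 4 ≤ S.re ^ 2 + S.im ^ 2 + S.re - (S.re ^ 2 + S.im ^ 2) * S.re := by
  have h := normSq_le_of_mem_closedBall hS
  obtain ⟨h0, h1⟩ := re_mem_of_mem_closedBall hS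
  set q := S.re ^ 2 + S.im ^ 2
  have hq : 0 ≤ q := by positivity
  rcases le_total S.re 1 with h2 | h2
  · nlinarith [mul_nonneg hq (sub_nonneg.2 h2)]
  · nlinarith [mul_nonneg (sub_nonneg.2 h) (sub_nonneg.2 h2), mul_nonneg h0 (sub_nonneg.2 h1)]

theorem norm_one_sub_sq_le {S : ℂ} (hS : S ∈ Metric.closedBall (3 / 4 : ℂ) (3 / 4)) :
    ‖1 - S ^ 2‖ ≤ ‖1 + 2 * S - S ^ 2‖ := by
  have h1 := normSq_one_add_two_mul_sub_sq_sub S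
  have h2 := re_div_four_le hS
  have h3 := (re_mem_of_mem_closedBall hS).1
  rw [Complex.normSq_eq_norm_sq, Complex.normSq_eq_norm_sq] at h1
  exact le_of_sq_le_sq (by linarith) (norm_nonneg _)

theorem one_add_two_mul_sub_sq_ne_zero {S : ℂ}
    (hS : S ∈ Metric.closedBall (3 / 4 : ℂ) (3 / 4)) : 1 + 2 * S - S ^ 2 ≠ 0 := by
  intro h
  have h1 := normSq_one_add_two_mul_sub_sq_sub S
  have h2 := re_div_four_le hS
  have h3 := (re_mem_of_mem_closedBall hS).1
  have h4 := normSq_le_of_mem_closedBall hS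
  have h5 := Complex.normSq_nonneg (1 - S ^ 2)
  rw [h, map_zero] at h1
  have hre : S.re = 0 := by linarith
  have him : S.im = 0 := by
    rw [hre] at h4
    nlinarith [sq_nonneg S.im]
  have : S = 0 := Complex.ext hre him
  rw [this] at h
  norm_num at h

theorem contourCoeff_circleIntegrable (n : ℕ) {F : ℂ → ℂ}
    (hF : ContinuousOn F (Metric.closedBall (3 / 4) (3 / 4))) :
    CircleIntegrable (fun S => 2 * S * F S * ((1 - S ^ 2) ^ (n + 1))⁻¹) (3 / 4) (3 / 4) := by
  refine ContinuousOn.circleIntegrable (by norm_num) ?_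
  refine ContinuousOn.mul ?_ (ContinuousOn.inv₀ (by fun_prop) fun S hS =>
    pow_ne_zero _ (one_sub_sq_ne_zero hS))
  exact ContinuousOn.mul (by fun_prop) (hF.mono Metric.sphere_subset_closedBall)

theorem contourCoeff_congr (n : ℕ) {F G : ℂ → ℂ}
    (h : ∀ S ∈ Metric.closedBall (3 / 4 : ℂ) (3 / 4), F S = G S) :
    contourCoeff n F = contourCoeff n G := by
  unfold contourCoeff
  rw [circleIntegral.integral_congr (by norm_num)]
  intro S hS
  simp only
  rw [h S (Metric.sphere_subset_closedBall hS)]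

theorem contourCoeff_add (n : ℕ) {F G : ℂ → ℂ}
    (hF : ContinuousOn F (Metric.closedBall (3 / 4) (3 / 4)))
    (hG : ContinuousOn G (Metric.closedBall (3 / 4) (3 / 4))) :
    contourCoeff n (fun S => F S + G S) = contourCoeff n F + contourCoeff n G := by
  unfold contourCoeff
  rw [← neg_add, ← mul_add, ← circleIntegral.integral_add (contourCoeff_circleIntegrable n hF)
    (contourCoeff_circleIntegrable n hG)]
  congr 3
  funext S
  ring

theorem contourCoeff_const_mul (n : ℕ) (c : ℂ) (F : ℂ → ℂ) :
    contourCoeff n (fun S => c * F S) = c * contourCoeff n F := by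
  unfold contourCoeff
  rw [mul_neg, mul_left_comm c, ← circleIntegral.integral_const_mul c]
  congr 3
  funext S
  ring

/-- Multiplication by `z = (1 - S ^ 2) / 4` shifts the coefficients. -/
theorem contourCoeff_succ_mul (n : ℕ) (F : ℂ → ℂ) :
    contourCoeff (n + 1) (fun S => (1 - S ^ 2) / 4 * F S) = contourCoeff n F := by
  unfold contourCoeff
  rw [← circleIntegral.integral_const_mul, ← circleIntegral.integral_const_mul]
  congr 1
  refine circleIntegral.integral_congr (by norm_num) fun S hS => ?_
  have := one_sub_sq_ne_zero hS
  simp only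
  field_simp
  ring

/-- Cauchy's formula for the simple pole at `S = 1`, the point where `z = 0`. -/
theorem contourCoeff_zero {F : ℂ → ℂ}
    (hF : DifferentiableOn ℂ F (Metric.closedBall (3 / 4) (3 / 4))) :
    contourCoeff 0 F = F 1 := by
  have hd : DifferentiableOn ℂ (fun S => 2 * S * F S / (1 + S))
      (Metric.closedBall (3 / 4) (3 / 4)) := by
    refine DifferentiableOn.div (DifferentiableOn.mul (by fun_prop) hF) (by fun_prop) fun S hS => ?_
    exact one_add_ne_zero_of_re_nonneg (re_mem_of_mem_closedBall hS).1
  have hw : (1 : ℂ) ∈ Metric.ball (3 / 4 : ℂ) (3 / 4) := by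
    rw [mem_ball_iff_norm]
    norm_num
  have hc := hd.circleIntegral_sub_inv_smul hw
  have hI : (2 * Real.pi * Complex.I : ℂ) ≠ 0 := by simp [Real.pi_ne_zero]
  have he : (∮ S in C(3 / 4, 3 / 4), 2 * S * F S * ((1 - S ^ 2) ^ (0 + 1))⁻¹)
      = -∮ S in C(3 / 4, 3 / 4), (S - 1)⁻¹ • (2 * S * F S / (1 + S)) := by
    rw [← neg_one_mul, ← circleIntegral.integral_const_mul]
    refine circleIntegral.integral_congr (by norm_num) fun S hS => ?_
    have h1 := one_sub_sq_ne_zero hS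
    rw [show 1 - S ^ 2 = -((S - 1) * (1 + S)) by ring] at h1
    have h2 : S - 1 ≠ 0 := fun h => h1 (by rw [h]; ring)
    have h3 : 1 + S ≠ 0 := fun h => h1 (by rw [h]; ring)
    simp only [smul_eq_mul, zero_add, pow_one]
    rw [show 1 - S ^ 2 = -((S - 1) * (1 + S)) by ring]
    field_simp
  unfold contourCoeff
  rw [he, hc, smul_eq_mul]
  field_simp
  ring

/-- The integrand has the primitive `(1 - S ^ 2) ^ (-(n + 1)) / (n + 1)`. -/
theorem contourCoeff_succ_one (n : ℕ) : contourCoeff (n + 1) (fun _ => 1) = 0 := by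
  unfold contourCoeff
  rw [circleIntegral.integral_eq_zero_of_hasDerivWithinAt
    (f := fun S : ℂ => ((1 - S ^ 2) ^ (n + 1))⁻¹ / ((n : ℂ) + 1)) (by norm_num), mul_zero, neg_zero]
  intro S hS
  have h := one_sub_sq_ne_zero hS
  have hn : (n + 1 : ℂ) ≠ 0 := by exact_mod_cast n.succ_ne_zero
  have h1 : HasDerivAt (fun S : ℂ => 1 - S ^ 2) (-(2 * S)) S := by
    simpa using (hasDerivAt_pow 2 S).const_sub 1
  have h2 := ((h1.pow (n + 1)).inv (pow_ne_zero _ h)).div_const (n + 1 : ℂ)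
  refine (h2.congr_deriv ?_).hasDerivWithinAt
  simp only [Nat.add_sub_cancel, Pi.pow_apply]
  push_cast
  field_simp
  ring

/-! ### The contour integral for the degree of symmetry -/

/-- The generating function `t` in `z = t / (1 + t) ^ 2`, as a function of `S = √(1 - 4z)`. -/
noncomputable def excursion (S : ℂ) : ℂ := (1 - S) / (1 + S)

/-- The generating function `(2z) ^ k / (S + 2z) ^ (k + 1)` of the closed lazy walks with `k` flat
steps at height `0`, as a function of `S = √(1 - 4z)`. -/
noncomputable def flatGF (k : ℕ) (S : ℂ) : ℂ :=
  2 * ((1 - S ^ 2) / (1 + 2 * S - S ^ 2)) ^ k / (1 + 2 * S - S ^ 2)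

theorem differentiableOn_excursion_pow (m : ℕ) :
    DifferentiableOn ℂ (fun S => excursion S ^ m) (Metric.closedBall (3 / 4) (3 / 4)) := by
  refine DifferentiableOn.pow (DifferentiableOn.div (by fun_prop) (by fun_prop) fun S hS => ?_) m
  exact one_add_ne_zero_of_re_nonneg (re_mem_of_mem_closedBall hS).1

theorem differentiableOn_flatGF (k : ℕ) :
    DifferentiableOn ℂ (flatGF k) (Metric.closedBall (3 / 4) (3 / 4)) := by
  have h : ∀ S ∈ Metric.closedBall (3 / 4 : ℂ) (3 / 4), 1 + 2 * S - S ^ 2 ≠ 0 :=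
    fun S hS => one_add_two_mul_sub_sq_ne_zero hS
  exact DifferentiableOn.div (DifferentiableOn.mul (by fun_prop)
    (DifferentiableOn.pow (DifferentiableOn.div (by fun_prop) (by fun_prop) h) k)) (by fun_prop) h

/-- Away from height `0` a lazy walk satisfies the ballot recursion, since
`t = z (1 + 2 t + t ^ 2)`. -/
theorem contourCoeff_excursion_pow_succ_mul (n m : ℕ) {F : ℂ → ℂ}
    (hF : DifferentiableOn ℂ F (Metric.closedBall (3 / 4) (3 / 4))) :
    contourCoeff (n + 1) (fun S => excursion S ^ (m + 1) * F S)
      = 2 * contourCoeff n (fun S => excursion S ^ (m + 1) * F S)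
        + contourCoeff n (fun S => excursion S ^ m * F S)
        + contourCoeff n (fun S => excursion S ^ (m + 2) * F S) := by
  have hc (j : ℕ) : ContinuousOn (fun S => excursion S ^ j * F S)
      (Metric.closedBall (3 / 4) (3 / 4)) :=
    ((differentiableOn_excursion_pow j).mul hF).continuousOn
  have hc2 : ContinuousOn (fun S => 2 * (excursion S ^ (m + 1) * F S))
      (Metric.closedBall (3 / 4) (3 / 4)) := continuousOn_const.mul (hc _)
  have hc3 : ContinuousOn (fun S => 2 * (excursion S ^ (m + 1) * F S) + excursion S ^ m * F S)
      (Metric.closedBall (3 / 4) (3 / 4)) := hc2.add (hc m)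
  rw [← contourCoeff_const_mul, ← contourCoeff_add n hc2 (hc m),
    ← contourCoeff_add n hc3 (hc (m + 2)), ← contourCoeff_succ_mul n (fun S => _ + _)]
  refine contourCoeff_congr _ fun S hS => ?_
  have h : 1 + S ≠ 0 := one_add_ne_zero_of_re_nonneg (re_mem_of_mem_closedBall hS).1
  have ht : excursion S = (1 - S ^ 2) / 4 * (2 * excursion S + 1 + excursion S ^ 2) := by
    unfold excursion
    field_simp
    ring
  calc excursion S ^ (m + 1) * F S = excursion S ^ m * F S * excursion S := by ring
    _ = excursion S ^ m * F S *
        ((1 - S ^ 2) / 4 * (2 * excursion S + 1 + excursion S ^ 2)) := by rw [← ht]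
    _ = _ := by ring

/-- A nontrivial closed walk begins with a flat step, or with an excursion above or below `0`. -/
theorem contourCoeff_flatGF_succ (n k : ℕ) :
    contourCoeff (n + 1) (flatGF (k + 1))
      = 2 * contourCoeff n (flatGF k)
        + 2 * contourCoeff n (fun S => excursion S ^ 1 * flatGF (k + 1) S) := by
  have hc : ContinuousOn (fun S => 2 * (excursion S ^ 1 * flatGF (k + 1) S))
      (Metric.closedBall (3 / 4) (3 / 4)) :=
    continuousOn_const.mul
      ((differentiableOn_excursion_pow 1).mul (differentiableOn_flatGF (k + 1))).continuousOn
  have hk : ContinuousOn (fun S => 2 * flatGF k S) (Metric.closedBall (3 / 4) (3 / 4)) :=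
    continuousOn_const.mul (differentiableOn_flatGF k).continuousOn
  rw [← contourCoeff_const_mul, ← contourCoeff_const_mul,
    ← contourCoeff_add n hk hc, ← contourCoeff_succ_mul n (fun S => _ + _)]
  refine contourCoeff_congr _ fun S hS => ?_
  have h : 1 + S ≠ 0 := one_add_ne_zero_of_re_nonneg (re_mem_of_mem_closedBall hS).1
  have h2 := one_add_two_mul_sub_sq_ne_zero hS
  unfold flatGF excursion
  rw [pow_succ _ k]
  generalize ((1 - S ^ 2) / (1 + 2 * S - S ^ 2)) ^ k = r
  field_simp
  ring

theorem contourCoeff_flatGF_zero (n : ℕ) :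
    contourCoeff (n + 1) (flatGF 0)
      = 2 * contourCoeff n (fun S => excursion S ^ 1 * flatGF 0 S) := by
  have hc : ContinuousOn (fun S => (1 - S ^ 2) / 4 * (2 * (excursion S ^ 1 * flatGF 0 S)))
      (Metric.closedBall (3 / 4) (3 / 4)) :=
    ContinuousOn.mul (by fun_prop) (continuousOn_const.mul
      ((differentiableOn_excursion_pow 1).mul (differentiableOn_flatGF 0)).continuousOn)
  rw [← contourCoeff_const_mul, ← contourCoeff_succ_mul n,
    ← zero_add (contourCoeff (n + 1) fun S => (1 - S ^ 2) / 4 * _),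
    ← contourCoeff_succ_one n, ← contourCoeff_add _ continuousOn_const hc]
  refine contourCoeff_congr _ fun S hS => ?_
  have h : 1 + S ≠ 0 := one_add_ne_zero_of_re_nonneg (re_mem_of_mem_closedBall hS).1
  have h2 := one_add_two_mul_sub_sq_ne_zero hS
  unfold flatGF excursion
  field_simp
  ring

/-- Both sides satisfy the same recursion in `n`, so no convergence of power series is involved. -/
theorem flatSum_eq_contourCoeff (n k : ℕ) (h : ℤ) :
    flatSum n h (fun j => if j = k then (1 : ℂ) else 0)
      = contourCoeff n (fun S => excursion S ^ h.natAbs * flatGF k S) := by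
  induction n generalizing h k with
  | zero =>
    have hd : DifferentiableOn ℂ (fun S => excursion S ^ h.natAbs * flatGF k S)
      (Metric.closedBall (3 / 4) (3 / 4)) :=
      (differentiableOn_excursion_pow _).mul (differentiableOn_flatGF k)
    rw [flatSum_zero, contourCoeff_zero hd]
    by_cases hh : h = 0
    · subst hh
      rcases eq_zero_or_exists_eq_succ k with rfl | ⟨k, rfl⟩
      · norm_num [flatGF]
      · simp [flatGF]
    · rw [if_neg hh]
      simp [excursion, hh]
  | succ n ih =>
    rcases eq_zero_or_exists_eq_succ h.natAbs with h0 | ⟨m, h0⟩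
    · obtain rfl : h = 0 := by omega
      rw [flatSum_succ_at_zero (F := fun m => contourCoeff n (fun S => excursion S ^ m * flatGF k S))
        (ih k)]
      simp only [Int.natAbs_zero, pow_zero, one_mul]
      rcases eq_zero_or_exists_eq_succ k with rfl | ⟨k, rfl⟩
      · rw [contourCoeff_flatGF_zero]
        simp [flatSum]
      · rw [contourCoeff_flatGF_succ]
        simp only [Nat.add_right_cancel_iff, ih k, Int.natAbs_zero, pow_zero, one_mul]
    · rw [flatSum_succ_of_ne_zero
        (F := fun m => contourCoeff n (fun S => excursion S ^ m * flatGF k S)) (ih k) h0, h0]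
      exact (contourCoeff_excursion_pow_succ_mul n m (differentiableOn_flatGF k)).symm

theorem contourCoeff_excursion_pow (n h : ℕ) :
    contourCoeff (n + 1) (fun S => excursion S ^ h)
      = ((2 * n + 1).choose (n + h) : ℂ) - (2 * n + 1).choose (n + h + 1) := by
  have hrec (n m : ℕ) := contourCoeff_excursion_pow_succ_mul n m (F := fun _ => 1)
    (differentiableOn_const 1)
  simp only [mul_one] at hrec
  have hzero (n : ℕ) : contourCoeff (n + 1) (fun S => excursion S ^ 0)
      = ((2 * n + 1).choose (n + 0) : ℂ) - (2 * n + 1).choose (n + 0 + 1) := by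
    simp only [pow_zero, contourCoeff_succ_one, add_zero]
    rw [← Nat.choose_symm_half, sub_self]
  induction n generalizing h with
  | zero =>
    rcases eq_zero_or_exists_eq_succ h with rfl | ⟨m, rfl⟩
    · exact hzero 0
    · have h0 (j : ℕ) := contourCoeff_zero (differentiableOn_excursion_pow j)
      rw [hrec, h0, h0, h0]
      rcases eq_zero_or_exists_eq_succ m with rfl | ⟨m, rfl⟩
      · simp [excursion]
      · simp [excursion, Nat.choose_eq_zero_of_lt]
  | succ n ih =>
    rcases eq_zero_or_exists_eq_succ h with rfl | ⟨m, rfl⟩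
    · exact hzero _
    · rw [hrec, ih, ih, ih]
      have e (a b : ℕ) : ((a + 2).choose (b + 2) : ℂ)
          = a.choose b + 2 * a.choose (b + 1) + a.choose (b + 2) := by
        rw [Nat.choose_succ_succ', Nat.choose_succ_succ', Nat.choose_succ_succ' a (b + 1)]
        push_cast
        ring
      rw [show 2 * (n + 1) + 1 = 2 * n + 1 + 2 by ring, show n + 1 + (m + 1) = n + m + 2 by ring,
        show n + m + 2 + 1 = n + m + 1 + 2 by ring, e, e, show n + (m + 1) = n + m + 1 by ring,
        show n + (m + 2) = n + m + 2 by ring]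
      ring

/-- The ballot theorem, for the first passage of a lazy walk to height `h`. -/
theorem mul_contourCoeff_excursion_pow (n h : ℕ) :
    (n + 1) * contourCoeff (n + 1) (fun S => excursion S ^ h) = h * (walkCount (n + 1) h : ℝ) := by
  rw [contourCoeff_excursion_pow, walkCount, show 2 * (n + 1) = 2 * n + 1 + 1 by ring,
    show n + 1 + h = n + h + 1 by ring, Nat.choose_succ_succ' (2 * n + 1)]
  push_cast
  rcases le_or_gt h (n + 1) with hh | hh
  · have e := Nat.choose_succ_right_eq (2 * n + 1) (n + h)
    have e2 : ((2 * n + 1 - (n + h) : ℕ) : ℂ) = n + 1 - h := by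
      rw [Nat.cast_sub (by omega)]
      push_cast
      ring
    have e3 := congrArg (Nat.cast : ℕ → ℂ) e
    push_cast [e2] at e3
    linear_combination -e3
  · rw [Nat.choose_eq_zero_of_lt (by omega), Nat.choose_eq_zero_of_lt (by omega)]
    simp

/-! ### Estimates on the contour -/

theorem norm_sq_eq_of_mem_sphere {S : ℂ} (hS : S ∈ Metric.sphere (3 / 4 : ℂ) (3 / 4)) :
    ‖S‖ ^ 2 = 3 / 2 * S.re := by
  rw [← Complex.normSq_eq_norm_sq, Complex.normSq_apply, ← normSq_eq_of_mem_sphere hS]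
  ring

theorem one_add_le_norm_one_sub_sq {S : ℂ} (hS : S ∈ Metric.sphere (3 / 4 : ℂ) (3 / 4)) :
    1 + ‖S‖ ^ 2 / 4 ≤ ‖1 - S ^ 2‖ ^ 2 := by
  obtain ⟨h0, h1⟩ := re_mem_of_mem_closedBall (Metric.sphere_subset_closedBall hS)
  have hq := normSq_eq_of_mem_sphere hS
  have e : ‖1 - S ^ 2‖ ^ 2 = (1 - 2 * S.re + (S.re ^ 2 + S.im ^ 2))
      * (1 + 2 * S.re + (S.re ^ 2 + S.im ^ 2)) := by
    rw [← Complex.normSq_eq_norm_sq]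
    simp [Complex.normSq_apply, pow_two]
    ring
  rw [e, norm_sq_eq_of_mem_sphere hS, hq]
  nlinarith [mul_nonneg h0 (sub_nonneg.2 h1)]

theorem exp_half_le_one_add {u : ℝ} (h0 : 0 ≤ u) (h1 : u ≤ 1) : Real.exp (u / 2) ≤ 1 + u := by
  have h2 : 1 - u / 2 ≤ Real.exp (-(u / 2)) := by
    have := Real.add_one_le_exp (-(u / 2))
    linarith
  have h3 : Real.exp (u / 2) * Real.exp (-(u / 2)) = 1 := by rw [← Real.exp_add]; simp
  have h4 := Real.exp_pos (u / 2)
  have h5 : Real.exp (u / 2) * (1 - u / 2) ≤ 1 :=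
    (mul_le_mul_of_nonneg_left h2 h4.le).trans_eq h3
  by_contra! h
  nlinarith [mul_nonneg h0 (sub_nonneg.2 h1),
    mul_lt_mul_of_pos_right h (by linarith : 0 < 1 - u / 2)]

theorem norm_le_of_mem_sphere {S : ℂ} (hS : S ∈ Metric.sphere (3 / 4 : ℂ) (3 / 4)) :
    ‖S‖ ^ 2 ≤ 9 / 4 := by
  rw [norm_sq_eq_of_mem_sphere hS]
  linarith [(re_mem_of_mem_closedBall (Metric.sphere_subset_closedBall hS)).2]

theorem exp_le_norm_one_sub_sq {S : ℂ} (hS : S ∈ Metric.sphere (3 / 4 : ℂ) (3 / 4)) :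
    Real.exp (‖S‖ ^ 2 / 16) ≤ ‖1 - S ^ 2‖ := by
  have h1 := exp_half_le_one_add (u := ‖S‖ ^ 2 / 4) (by positivity)
    (by linarith [norm_le_of_mem_sphere hS])
  refine le_of_sq_le_sq ?_ (norm_nonneg _)
  refine le_trans (le_of_eq ?_) (h1.trans (one_add_le_norm_one_sub_sq hS))
  rw [← Real.exp_nat_mul]
  congr 1
  push_cast
  ring

theorem norm_inv_one_sub_sq_pow_le {S : ℂ} (hS : S ∈ Metric.sphere (3 / 4 : ℂ) (3 / 4)) (n : ℕ) :
    ‖((1 - S ^ 2) ^ (n + 1))⁻¹‖ ≤ Real.exp (-(n * (‖S‖ ^ 2 / 16))) := by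
  have h1 := exp_le_norm_one_sub_sq hS
  have h2 : 1 ≤ Real.exp (‖S‖ ^ 2 / 16) := Real.one_le_exp (by positivity)
  rw [norm_inv, norm_pow, Real.exp_neg, Real.exp_nat_mul]
  gcongr
  calc Real.exp (‖S‖ ^ 2 / 16) ^ n ≤ ‖1 - S ^ 2‖ ^ n := by gcongr
    _ ≤ ‖1 - S ^ 2‖ ^ (n + 1) := pow_le_pow_right₀ (h2.trans h1) (Nat.le_succ n)

theorem norm_pow_sub_pow_le {a b : ℂ} (ha : ‖a‖ ≤ 1) (hb : ‖b‖ ≤ 1) (k : ℕ) :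
    ‖a ^ k - b ^ k‖ ≤ k * ‖a - b‖ := by
  induction k with
  | zero => simp
  | succ k ih =>
    have e : a ^ (k + 1) - b ^ (k + 1) = a * (a ^ k - b ^ k) + (a - b) * b ^ k := by ring
    rw [e]
    refine (norm_add_le _ _).trans ?_
    rw [norm_mul, norm_mul, norm_pow]
    have h1 : ‖a‖ * ‖a ^ k - b ^ k‖ ≤ 1 * (k * ‖a - b‖) := by gcongr
    have h2 : ‖a - b‖ * ‖b‖ ^ k ≤ ‖a - b‖ * 1 := by
      gcongr
      exact pow_le_one₀ (norm_nonneg _) hb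
    push_cast
    linarith

theorem norm_excursion_le {S : ℂ} (hS : 0 ≤ S.re) : ‖excursion S‖ ≤ 1 := by
  have h := one_add_ne_zero_of_re_nonneg hS
  unfold excursion
  rw [norm_div, div_le_one (norm_pos_iff.2 h)]
  refine le_of_sq_le_sq ?_ (norm_nonneg _)
  rw [← Complex.normSq_eq_norm_sq, ← Complex.normSq_eq_norm_sq]
  simp [Complex.normSq_apply]
  nlinarith

/-- Near the branch point `S = 0` the weight `(1 - S ^ 2) / (1 + 2 S - S ^ 2)` of a flat step differs
from `t = (1 - S) / (1 + S)` by `O(S ^ 2)`, and both are bounded by `1` on the contour. -/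
theorem norm_flatGF_sub_le {S : ℂ} (hS : S ∈ Metric.sphere (3 / 4 : ℂ) (3 / 4)) (k : ℕ) :
    ‖flatGF k S - 2 * excursion S ^ k‖ ≤ 4 * ‖S‖ + 4 * k * ‖S‖ ^ 2 := by
  have hb := Metric.sphere_subset_closedBall hS
  have hre := (re_mem_of_mem_closedBall hb).1
  have hd := one_add_two_mul_sub_sq_ne_zero hb
  have hs := one_add_ne_zero_of_re_nonneg hre
  have h1 : 1 ≤ ‖1 - S ^ 2‖ :=
    (Real.one_le_exp (by positivity)).trans (exp_le_norm_one_sub_sq hS)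
  have h2 := norm_one_sub_sq_le hb
  have h3 : 1 ≤ ‖1 + 2 * S - S ^ 2‖ := h1.trans h2
  have ht := norm_excursion_le hre
  set d := 1 + 2 * S - S ^ 2 with hdd
  set ρ := (1 - S ^ 2) / d with hρ
  have hρ1 : ‖ρ‖ ≤ 1 := by
    rw [hρ, norm_div]
    exact div_le_one_of_le₀ h2 (norm_nonneg _)
  have hdiff : ρ - excursion S = excursion S * (2 * S ^ 2) / d := by
    rw [hρ]
    unfold excursion
    field_simp
    rw [hdd]
    ring
  have hdiff' : ‖ρ - excursion S‖ ≤ 2 * ‖S‖ ^ 2 := by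
    rw [hdiff, norm_div, norm_mul, norm_mul, norm_pow]
    refine (div_le_self (by positivity) h3).trans ?_
    norm_num
    nlinarith [sq_nonneg ‖S‖]
  have hinv : ‖1 / d - 1‖ ≤ 2 * ‖S‖ := by
    have e : 1 / d - 1 = S * (S - 2) / d := by
      field_simp
      rw [hdd]
      ring
    have h5 : ‖S - 2‖ ≤ 2 := by
      have e2 : S - 2 = (S - 3 / 4) - 5 / 4 := by ring
      have e3 : ‖S - 3 / 4‖ = 3 / 4 := mem_sphere_iff_norm.1 hS
      rw [e2]
      refine (norm_sub_le _ _).trans ?_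
      rw [e3]
      norm_num
    rw [e, norm_div, norm_mul]
    refine (div_le_self (by positivity) h3).trans ?_
    nlinarith [norm_nonneg S]
  have e : flatGF k S - 2 * excursion S ^ k
      = 2 * (ρ ^ k * (1 / d - 1) + (ρ ^ k - excursion S ^ k)) := by
    unfold flatGF
    rw [← hdd, ← hρ]
    ring
  have h6 := norm_pow_sub_pow_le hρ1 ht k
  have h7 : ‖ρ ^ k * (1 / d - 1)‖ ≤ 1 * (2 * ‖S‖) := by
    rw [norm_mul, norm_pow]
    gcongr
    exact pow_le_one₀ (norm_nonneg _) hρ1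
  have h8 : (k : ℝ) * ‖ρ - excursion S‖ ≤ k * (2 * ‖S‖ ^ 2) := by gcongr
  rw [e, norm_mul, Complex.norm_ofNat]
  have h9 := norm_add_le (ρ ^ k * (1 / d - 1)) (ρ ^ k - excursion S ^ k)
  linarith

/-- The squared distance to the branch point, in the angle measured from it. -/
theorem norm_circleMap_sq (ψ : ℝ) :
    ‖circleMap (3 / 4) (3 / 4) (ψ + Real.pi)‖ ^ 2 = 9 / 8 * (1 - Real.cos ψ) := by
  rw [norm_sq_eq_of_mem_sphere (circleMap_mem_sphere _ (by norm_num) _)]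
  have : (circleMap (3 / 4) (3 / 4) (ψ + Real.pi)).re = 3 / 4 - 3 / 4 * Real.cos ψ := by
    rw [circleMap, Complex.exp_mul_I, ← Complex.ofReal_cos, ← Complex.ofReal_sin, Real.cos_add_pi,
      Real.sin_add_pi]
    simp
    rw [← Complex.ofReal_cos, Complex.ofReal_re]
    norm_num
    ring
  rw [this]
  ring

theorem norm_circleMap_le (ψ : ℝ) : ‖circleMap (3 / 4) (3 / 4) (ψ + Real.pi)‖ ≤ |ψ| := by
  refine le_of_sq_le_sq ?_ (abs_nonneg _)
  rw [norm_circleMap_sq, sq_abs]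
  nlinarith [Real.one_sub_sq_div_two_le_cos (x := ψ), sq_nonneg ψ]

theorem le_norm_circleMap_sq {ψ : ℝ} (hψ : |ψ| ≤ Real.pi) :
    ψ ^ 2 / 5 ≤ ‖circleMap (3 / 4) (3 / 4) (ψ + Real.pi)‖ ^ 2 := by
  rw [norm_circleMap_sq]
  have h := Real.cos_le_one_sub_mul_cos_sq hψ
  have hpi : 1 / 10 ≤ 1 / Real.pi ^ 2 := by
    have := Real.pi_pos
    apply one_div_le_one_div_of_le (by positivity)
    nlinarith [Real.pi_lt_d2]
  have h2 : 2 / Real.pi ^ 2 = 2 * (1 / Real.pi ^ 2) := by ring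
  rw [h2] at h
  nlinarith [mul_le_mul_of_nonneg_right hpi (sq_nonneg ψ), sq_nonneg ψ]

theorem integrable_abs_pow_mul_exp (q : ℕ) {b : ℝ} (hb : 0 < b) :
    Integrable fun x : ℝ => |x| ^ q * Real.exp (-b * |x| ^ 2) := by
  have h := integrable_rpow_mul_exp_neg_mul_sq hb (s := q) (by linarith [q.cast_nonneg (α := ℝ)])
  refine h.abs.congr (Eventually.of_forall fun x => ?_)
  simp [abs_mul, abs_pow]

theorem integral_abs_pow_mul_exp (q : ℕ) {b : ℝ} (hb : 0 < b) :
    ∫ x : ℝ, |x| ^ q * Real.exp (-b * |x| ^ 2)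
      = b ^ (-((q : ℝ) + 1) / 2) * Real.Gamma (((q : ℝ) + 1) / 2) := by
  rw [integral_comp_abs (f := fun x => x ^ q * Real.exp (-b * x ^ 2))]
  have h := integral_rpow_mul_exp_neg_mul_rpow (p := 2) (q := q) (by norm_num)
    (by linarith [q.cast_nonneg (α := ℝ)]) hb
  simp only [Real.rpow_natCast, Real.rpow_ofNat] at h
  rw [h]
  ring

/-- The contour integral is dominated by the Gaussian factor `(1 - S ^ 2) ^ (-(n + 1))`, which has
width `n ^ (-1/2)` around the branch point. -/
theorem exists_norm_contourCoeff_flatGF_sub_le :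
    ∃ C : ℝ, 0 ≤ C ∧ ∀ n : ℕ, 1 ≤ n → ∀ k : ℕ,
      ‖contourCoeff n (flatGF k) - 2 * contourCoeff n (fun S => excursion S ^ k)‖
        ≤ C * 4 ^ n * ((n : ℝ) ^ (-(3 / 2) : ℝ) + k * (n : ℝ) ^ (-2 : ℝ)) := by
  -- `80 = 5 * 16`: the kernel is at most `exp (-n |S| ^ 2 / 16)`, and `|S| ^ 2 ≥ ψ ^ 2 / 5` at the
  -- angle `ψ` from the branch point.
  set A := (80 : ℝ)⁻¹ ^ (-(3 / 2) : ℝ) * Real.Gamma (3 / 2) with hA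
  set B := (80 : ℝ)⁻¹ ^ (-2 : ℝ) * Real.Gamma 2 with hB
  have hA0 : 0 ≤ A := mul_nonneg (by positivity) (Real.Gamma_pos_of_pos (by norm_num)).le
  have hB0 : 0 ≤ B := mul_nonneg (by positivity) (Real.Gamma_pos_of_pos (by norm_num)).le
  refine ⟨6 * (2 * Real.pi)⁻¹ * (A + B), by positivity, fun n hn k => ?_⟩
  have hn0 : (0 : ℝ) < n := by exact_mod_cast hn
  set b : ℝ := 80⁻¹ * n with hb
  have hb0 : 0 < b := by positivity
  have hc : ContinuousOn (fun S => -2 * excursion S ^ k) (Metric.closedBall (3 / 4) (3 / 4)) :=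
    continuousOn_const.mul (differentiableOn_excursion_pow k).continuousOn
  have e1 : contourCoeff n (flatGF k) - 2 * contourCoeff n (fun S => excursion S ^ k)
      = contourCoeff n (fun S => flatGF k S + -2 * excursion S ^ k) := by
    rw [contourCoeff_add n (differentiableOn_flatGF k).continuousOn hc, contourCoeff_const_mul]
    ring
  set G : ℝ → ℝ := fun x => |x| ^ 2 * Real.exp (-b * |x| ^ 2)
    + k * (|x| ^ 3 * Real.exp (-b * |x| ^ 2)) with hG
  have hGi : Integrable G :=
    (integrable_abs_pow_mul_exp 2 hb0).add ((integrable_abs_pow_mul_exp 3 hb0).const_mul _)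
  have hG0 : ∀ x, 0 ≤ G x := fun x => by positivity
  have hGint : ∫ x, G x = A * (n : ℝ) ^ (-(3 / 2) : ℝ) + k * (B * (n : ℝ) ^ (-2 : ℝ)) := by
    rw [hG, integral_add (integrable_abs_pow_mul_exp 2 hb0)
      ((integrable_abs_pow_mul_exp 3 hb0).const_mul _), integral_const_mul,
      integral_abs_pow_mul_exp 2 hb0, integral_abs_pow_mul_exp 3 hb0, hb,
      Real.mul_rpow (by positivity) hn0.le, Real.mul_rpow (by positivity) hn0.le, hA, hB]
    norm_num
    ring
  have hbound : ‖∮ S in C(3 / 4, 3 / 4),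
      2 * S * (flatGF k S + -2 * excursion S ^ k) * ((1 - S ^ 2) ^ (n + 1))⁻¹‖
      ≤ 6 * ∫ x, G x := by
    have h1 : ∀ θ ∈ Set.Ioc 0 (2 * Real.pi), ‖deriv (circleMap (3 / 4) (3 / 4)) θ •
        (2 * circleMap (3 / 4) (3 / 4) θ * (flatGF k (circleMap (3 / 4) (3 / 4) θ)
          + -2 * excursion (circleMap (3 / 4) (3 / 4) θ) ^ k)
          * ((1 - circleMap (3 / 4) (3 / 4) θ ^ 2) ^ (n + 1))⁻¹)‖ ≤ 6 * G (θ - Real.pi) := by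
      intro θ hθ
      have hS : circleMap (3 / 4) (3 / 4) θ ∈ Metric.sphere (3 / 4 : ℂ) (3 / 4) :=
        circleMap_mem_sphere _ (by norm_num) _
      have hψ : |θ - Real.pi| ≤ Real.pi := by
        rw [abs_le]
        constructor <;> linarith [hθ.1, hθ.2]
      have b1 := norm_circleMap_le (θ - Real.pi)
      have b2 := le_norm_circleMap_sq hψ
      rw [sub_add_cancel] at b1 b2
      have b3 := norm_flatGF_sub_le hS k
      have b4 := norm_inv_one_sub_sq_pow_le hS n
      rw [sub_eq_add_neg, ← neg_mul] at b3
      have hder : ‖deriv (circleMap (3 / 4) (3 / 4)) θ‖ = 3 / 4 := by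
        simp [deriv_circleMap, circleMap]
      set S := circleMap (3 / 4) (3 / 4) θ
      set ψ := θ - Real.pi
      have b5 : ‖((1 - S ^ 2) ^ (n + 1))⁻¹‖ ≤ Real.exp (-b * |ψ| ^ 2) := by
        refine b4.trans (Real.exp_le_exp.2 ?_)
        rw [sq_abs, hb]
        nlinarith [mul_le_mul_of_nonneg_left b2 hn0.le]
      rw [norm_smul, norm_mul, norm_mul, norm_mul, hder, Complex.norm_ofNat]
      calc 3 / 4 * (2 * ‖S‖ * ‖flatGF k S + -2 * excursion S ^ k‖ * ‖((1 - S ^ 2) ^ (n + 1))⁻¹‖)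
          ≤ 3 / 4 * (2 * |ψ| * (4 * |ψ| + 4 * k * |ψ| ^ 2) * Real.exp (-b * |ψ| ^ 2)) := by
            have b6 : 4 * ‖S‖ + 4 * k * ‖S‖ ^ 2 ≤ 4 * |ψ| + 4 * k * |ψ| ^ 2 := by gcongr
            gcongr
            exact b3.trans b6
        _ = 6 * G ψ := by
            rw [hG]
            ring
    have h2 : IntervalIntegrable (fun θ => 6 * G (θ - Real.pi)) volume 0 (2 * Real.pi) :=
      ((hGi.comp_sub_right Real.pi).const_mul 6).intervalIntegrable
    unfold circleIntegral
    refine (intervalIntegral.norm_integral_le_of_norm_le (by positivity)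
      (Eventually.of_forall h1) h2).trans ?_
    rw [intervalIntegral.integral_const_mul, intervalIntegral.integral_of_le (by positivity)]
    have h3 := setIntegral_le_integral (s := Set.Ioc 0 (2 * Real.pi))
      (hGi.comp_sub_right Real.pi) (Eventually.of_forall fun x => hG0 _)
    rw [integral_sub_right_eq_self G (μ := volume)] at h3
    linarith
  have hI : ‖(2 * Real.pi * Complex.I : ℂ)⁻¹‖ = (2 * Real.pi)⁻¹ := by
    rw [norm_inv, norm_mul, norm_mul]
    simp [abs_of_pos Real.pi_pos]
  rw [e1]
  unfold contourCoeff
  rw [norm_neg, norm_mul, norm_mul, hI, norm_pow, Complex.norm_ofNat]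
  have hx : 0 ≤ (n : ℝ) ^ (-(3 / 2) : ℝ) := by positivity
  have hy : 0 ≤ (k : ℝ) * (n : ℝ) ^ (-2 : ℝ) := by positivity
  calc 4 ^ n * (2 * Real.pi)⁻¹ * ‖∮ S in C(3 / 4, 3 / 4),
        2 * S * (flatGF k S + -2 * excursion S ^ k) * ((1 - S ^ 2) ^ (n + 1))⁻¹‖
      ≤ 4 ^ n * (2 * Real.pi)⁻¹ * (6 * ((A + B) *
          ((n : ℝ) ^ (-(3 / 2) : ℝ) + k * (n : ℝ) ^ (-2 : ℝ)))) := by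
        gcongr
        refine hbound.trans ?_
        rw [hGint]
        have := mul_nonneg hA0 hy
        have := mul_nonneg hB0 hx
        nlinarith
    _ = _ := by ring

/-! ### Asymptotics of binomial coefficients -/

theorem wallis_eq (n : ℕ) :
    (4 ^ n / walkCount n 0) ^ 2 = (2 * n + 1) * Real.Wallis.W n := by
  have h := Nat.choose_mul_factorial_mul_factorial (show n ≤ 2 * n by omega)
  rw [show 2 * n - n = n by omega] at h
  have h1 : walkCount n 0 * (n.factorial : ℝ) * n.factorial = (2 * n).factorial := by
    unfold walkCount
    exact_mod_cast h
  have h2 := walkCount_zero_pos n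
  have h3 : (0 : ℝ) < n.factorial := by exact_mod_cast n.factorial_pos
  rw [Real.Wallis.W_eq_factorial_ratio, ← h1, show (2 : ℝ) ^ (4 * n) = (4 ^ n) ^ 2 by
    rw [← pow_mul, mul_comm n 2, pow_mul, pow_mul]; norm_num [← mul_pow, ← pow_mul, mul_comm]]
  field_simp

theorem pi_mul_le_sq (n : ℕ) : Real.pi * n ≤ (4 ^ n / walkCount n 0) ^ 2 := by
  rw [wallis_eq]
  have h := Real.Wallis.le_W n
  have hn : (0 : ℝ) ≤ n := n.cast_nonneg
  have h2 : Real.pi * n ≤ (2 * n + 1) * ((2 * (n : ℝ) + 1) / (2 * n + 2) * (Real.pi / 2)) := by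
    rw [div_mul_eq_mul_div, mul_div_assoc', le_div_iff₀ (by positivity)]
    nlinarith [Real.pi_pos]
  exact h2.trans (mul_le_mul_of_nonneg_left h (by positivity))

theorem sq_le_pi_mul (n : ℕ) : (4 ^ n / walkCount n 0) ^ 2 ≤ Real.pi * (n + 1 / 2) := by
  rw [wallis_eq]
  have h := Real.Wallis.W_le n
  have := mul_le_mul_of_nonneg_left h (by positivity : (0 : ℝ) ≤ 2 * n + 1)
  linarith

theorem four_pow_div_walkCount_le {n : ℕ} (hn : 1 ≤ n) :
    4 ^ n / walkCount n 0 ≤ 3 * Real.sqrt n := by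
  have hn' : (1 : ℝ) ≤ n := by exact_mod_cast hn
  refine le_of_sq_le_sq ?_ (by positivity)
  rw [mul_pow, Real.sq_sqrt (by positivity)]
  refine (sq_le_pi_mul n).trans ?_
  nlinarith [Real.pi_le_four, Real.pi_pos]

theorem walkCount_succ_mul {n k : ℕ} (hk : k ≤ n) :
    walkCount n (k + 1) * (n + k + 1) = walkCount n k * (n - k) := by
  have e := Nat.choose_succ_right_eq (2 * n) (n + k)
  have e2 : ((2 * n - (n + k) : ℕ) : ℝ) = n - k := by
    rw [Nat.cast_sub (by omega)]
    push_cast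
    ring
  have e3 := congrArg (Nat.cast : ℕ → ℝ) e
  push_cast [e2] at e3
  exact e3

theorem walkCount_nonneg (n k : ℕ) : 0 ≤ walkCount n k := by
  unfold walkCount
  positivity

/-- The denominator `n + k` is kept fixed while `j` runs up to `k`, so that the exponents of the
successive ratios `(n - j) / (n + j + 1)` add up to a square. -/
theorem walkCount_le_exp {n k : ℕ} (hk : k ≤ n) {j : ℕ} (hj : j ≤ k) :
    walkCount n j ≤ walkCount n 0 * Real.exp (-((j : ℝ) ^ 2 / (n + k))) := by
  induction j with
  | zero => simp
  | succ j ih =>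
    have ih := ih (by omega)
    have hjk : (j : ℝ) + 1 ≤ k := by exact_mod_cast hj
    have hkn : (k : ℝ) ≤ n := by exact_mod_cast hk
    have h0 : (0 : ℝ) < n + j + 1 := by positivity
    have h1 : (n - j : ℝ) / (n + j + 1) ≤ Real.exp (-((2 * j + 1) / (n + k))) := by
      have h2 := Real.add_one_le_exp (-((2 * j + 1) / (n + k) : ℝ))
      have h3 : (2 * j + 1) / (n + k) ≤ ((2 * j + 1) / (n + j + 1) : ℝ) :=
        div_le_div_of_nonneg_left (by positivity) h0 (by linarith)
      have h4 : (n - j : ℝ) / (n + j + 1) = -((2 * j + 1) / (n + j + 1)) + 1 := by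
        field_simp
        ring
      linarith
    have h5 : walkCount n (j + 1) = walkCount n j * ((n - j) / (n + j + 1)) := by
      rw [mul_div_assoc', eq_div_iff h0.ne', walkCount_succ_mul (by omega)]
    have h6 : (0 : ℝ) ≤ (n - j) / (n + j + 1) := div_nonneg (by linarith) h0.le
    rw [h5]
    calc walkCount n j * ((n - j) / (n + j + 1))
        ≤ walkCount n 0 * Real.exp (-((j : ℝ) ^ 2 / (n + k)))
          * Real.exp (-((2 * j + 1) / (n + k))) := by
          gcongr
          exact mul_nonneg (walkCount_nonneg _ _) (Real.exp_pos _).le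
      _ = _ := by
          rw [mul_assoc, ← Real.exp_add]
          congr 2
          push_cast
          ring

theorem exp_le_walkCount {n k : ℕ} (hk : k ≤ n) {j : ℕ} (hj : j ≤ k) :
    walkCount n 0 * Real.exp (-((j : ℝ) ^ 2 / (n - k + 1))) ≤ walkCount n j := by
  induction j with
  | zero => simp
  | succ j ih =>
    have ih := ih (by omega)
    have hjk : (j : ℝ) + 1 ≤ k := by exact_mod_cast hj
    have hkn : (k : ℝ) ≤ n := by exact_mod_cast hk
    have h0 : (0 : ℝ) < n + j + 1 := by positivity
    have h00 : (0 : ℝ) < n - j := by linarith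
    have h01 : (0 : ℝ) < n - k + 1 := by linarith
    have h1 : Real.exp (-((2 * j + 1) / (n - k + 1))) ≤ (n - j : ℝ) / (n + j + 1) := by
      have h2 := Real.add_one_le_exp ((2 * j + 1) / (n - k + 1) : ℝ)
      have h3 : ((2 * j + 1) / (n - j) : ℝ) ≤ (2 * j + 1) / (n - k + 1) := by
        gcongr
        linarith
      have h4 : (n + j + 1 : ℝ) / (n - j) = (2 * j + 1) / (n - j) + 1 := by
        field_simp
        ring
      rw [Real.exp_neg, ← inv_div (n + j + 1 : ℝ)]
      exact inv_anti₀ (div_pos h0 h00) (by linarith)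
    have h5 : walkCount n (j + 1) = walkCount n j * ((n - j) / (n + j + 1)) := by
      rw [mul_div_assoc', eq_div_iff h0.ne', walkCount_succ_mul (by omega)]
    rw [h5]
    calc walkCount n 0 * Real.exp (-(((j + 1 : ℕ) : ℝ) ^ 2 / (n - k + 1)))
        = walkCount n 0 * Real.exp (-((j : ℝ) ^ 2 / (n - k + 1)))
          * Real.exp (-((2 * j + 1) / (n - k + 1))) := by
          rw [mul_assoc, ← Real.exp_add]
          congr 2
          push_cast
          ring
      _ ≤ _ := by
          gcongr
          exact walkCount_nonneg _ _

theorem exp_neg_le_two_div_sq {y : ℝ} (hy : 0 < y) : Real.exp (-y) ≤ 2 / y ^ 2 := by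
  have h := Real.quadratic_le_exp_of_nonneg hy.le
  rw [Real.exp_neg, ← inv_div]
  gcongr
  linarith

theorem exp_neg_sub_exp_neg_le (a b : ℝ) :
    Real.exp (-a) - Real.exp (-b) ≤ Real.exp (-a) * (b - a) := by
  have h1 : Real.exp (-b) = Real.exp (-a) * Real.exp (-(b - a)) := by
    rw [← Real.exp_add]
    ring_nf
  have h2 := Real.add_one_le_exp (-(b - a))
  nlinarith [Real.exp_pos (-a)]

/-- A quantitative local limit theorem for the lazy walk, weighted by the height `k`. -/
theorem abs_walkCount_ratio_sub_exp_le {n : ℕ} (hn : 1 ≤ n) (k : ℕ) :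
    |2 * k / n * (walkCount n k / walkCount n 0) - 2 * k / n * Real.exp (-(k : ℝ) ^ 2 / n)|
      ≤ 32 * (n : ℝ)⁻¹ := by
  have hn0 : (1 : ℝ) ≤ n := by exact_mod_cast hn
  rcases Nat.eq_zero_or_pos k with rfl | hk
  · simp
  have hk0 : (1 : ℝ) ≤ k := by exact_mod_cast hk
  have hw := walkCount_zero_pos n
  rw [neg_div, ← mul_sub, abs_mul, abs_of_nonneg (by positivity : (0 : ℝ) ≤ 2 * k / n)]
  suffices h : |walkCount n k / walkCount n 0 - Real.exp (-((k : ℝ) ^ 2 / n))| ≤ 16 / k by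
    calc (2 * k / n : ℝ) * |walkCount n k / walkCount n 0 - Real.exp (-((k : ℝ) ^ 2 / n))|
        ≤ 2 * k / n * (16 / k) := by gcongr
      _ = 32 * (n : ℝ)⁻¹ := by field_simp; ring
  have hR0 : 0 ≤ walkCount n k / walkCount n 0 := div_nonneg (walkCount_nonneg _ _) hw.le
  have hx : Real.exp (-((k : ℝ) ^ 2 / n)) ≤ 2 * n ^ 2 / k ^ 4 := by
    refine (exp_neg_le_two_div_sq (by positivity)).trans_eq ?_
    field_simp
  rw [abs_le]
  constructor
  -- For `2 k > n` the Gaussian alone is within the error.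
  · rcases le_or_gt (2 * k) n with h2 | h2
    · have h2' : (2 * k : ℝ) ≤ n := by exact_mod_cast h2
      have h3 : Real.exp (-((k : ℝ) ^ 2 / (n - k + 1))) ≤ walkCount n k / walkCount n 0 := by
        rw [le_div_iff₀ hw, mul_comm]
        exact exp_le_walkCount (by omega) le_rfl
      have h4 := exp_neg_sub_exp_neg_le ((k : ℝ) ^ 2 / n) ((k : ℝ) ^ 2 / (n - k + 1))
      have h01 : (0 : ℝ) < n - k + 1 := by linarith
      have h5 : (k : ℝ) ^ 2 / (n - k + 1) - (k : ℝ) ^ 2 / n ≤ 2 * k ^ 3 / n ^ 2 := by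
        rw [div_sub_div _ _ h01.ne' (by positivity), div_le_div_iff₀ (by positivity) (by positivity)]
        have e : (k : ℝ) ^ 2 * n - (n - k + 1) * k ^ 2 = k ^ 2 * (k - 1) := by ring
        rw [e]
        have h6 : (n : ℝ) ≤ 2 * (n - k + 1) := by linarith
        calc (k : ℝ) ^ 2 * (k - 1) * n ^ 2 ≤ k ^ 2 * k * (n * (2 * (n - k + 1))) := by
              rw [sq (n : ℝ)]
              gcongr
              linarith
          _ = _ := by ring
      have h7 : Real.exp (-((k : ℝ) ^ 2 / n)) * ((k : ℝ) ^ 2 / (n - k + 1) - (k : ℝ) ^ 2 / n)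
          ≤ 2 * n ^ 2 / k ^ 4 * (2 * k ^ 3 / n ^ 2) := by
        refine (mul_le_mul_of_nonneg_left h5 (Real.exp_pos _).le).trans ?_
        gcongr
      have h8 : (2 * n ^ 2 / k ^ 4 * (2 * k ^ 3 / n ^ 2) : ℝ) = 4 / k := by
        field_simp
        ring
      have h9 : (4 / k : ℝ) ≤ 16 / k := by gcongr; norm_num
      linarith
    · have h2' : (n : ℝ) ≤ 2 * k := by exact_mod_cast h2.le
      have h3 : (2 * n ^ 2 / k ^ 4 : ℝ) ≤ 16 / k := by
        rw [div_le_div_iff₀ (by positivity) (by positivity)]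
        calc (2 * n ^ 2 * k : ℝ) ≤ 2 * (2 * k) ^ 2 * k := by gcongr
          _ = 8 * k ^ 3 * 1 := by ring
          _ ≤ 16 * k ^ 3 * k := by gcongr; norm_num
          _ = 16 * k ^ 4 := by ring
      linarith
  · rcases le_or_gt k n with h2 | h2
    · have h2' : (k : ℝ) ≤ n := by exact_mod_cast h2
      have h3 : walkCount n k / walkCount n 0 ≤ Real.exp (-((k : ℝ) ^ 2 / (n + k))) := by
        rw [div_le_iff₀ hw, mul_comm]
        exact walkCount_le_exp h2 le_rfl
      have h4 := exp_neg_sub_exp_neg_le ((k : ℝ) ^ 2 / (n + k)) ((k : ℝ) ^ 2 / n)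
      have h5 : (k : ℝ) ^ 2 / n - (k : ℝ) ^ 2 / (n + k) = k ^ 3 / (n * (n + k)) := by
        field_simp
        ring
      have h6 : Real.exp (-((k : ℝ) ^ 2 / (n + k))) ≤ 2 * (n + k) ^ 2 / k ^ 4 := by
        refine (exp_neg_le_two_div_sq (by positivity)).trans_eq ?_
        field_simp
      have h7 : Real.exp (-((k : ℝ) ^ 2 / (n + k))) * (k ^ 3 / (n * (n + k)))
          ≤ 2 * (n + k) ^ 2 / k ^ 4 * (k ^ 3 / (n * (n + k))) := by gcongr
      have h8 : (2 * (n + k) ^ 2 / k ^ 4 * (k ^ 3 / (n * (n + k))) : ℝ) ≤ 16 / k := by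
        have e : (2 * (n + k) ^ 2 / k ^ 4 * (k ^ 3 / (n * (n + k))) : ℝ)
            = 2 * (n + k) / n / k := by field_simp
        rw [e]
        gcongr
        rw [div_le_iff₀ (by positivity)]
        linarith
      rw [h5] at h4
      linarith
    · have h3 : walkCount n k = 0 := by
        unfold walkCount
        rw [Nat.choose_eq_zero_of_lt (by omega)]
        simp
      rw [h3, zero_div]
      have := Real.exp_pos (-((k : ℝ) ^ 2 / n))
      have : (0 : ℝ) ≤ 16 / k := by positivity
      linarith

/-! ### The local law -/

namespace GrandDyckPath

theorem flatSum_ofReal (n k : ℕ) (h : ℤ) :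
    ((flatSum n h (fun j => if j = k then (1 : ℝ) else 0) : ℝ) : ℂ)
      = flatSum n h (fun j => if j = k then (1 : ℂ) else 0) := by
  unfold flatSum
  rw [Complex.ofReal_sum]
  refine Finset.sum_congr rfl fun v _ => ?_
  by_cases h1 : foldHeight v n = h <;> by_cases h2 : flats v = k <;> simp [h1, h2]

/-- The flat-step generating function is replaced by `2 t ^ k`, at the cost of
`exists_norm_contourCoeff_flatGF_sub_le`, and the ballot number by its Gaussian approximation. -/
theorem exists_abs_uniform_real_degSymm_sub_le :
    ∃ C : ℝ, ∀ n : ℕ, 1 ≤ n → ∀ k : ℕ,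
      |(uniform n).real {P | P.degSymm = k} - 2 * k / n * Real.exp (-(k : ℝ) ^ 2 / n)|
        ≤ C * (((k : ℝ) + 1) * (n : ℝ) ^ (-(3 / 2) : ℝ) + (n : ℝ)⁻¹) := by
  obtain ⟨C, hC0, hC⟩ := exists_norm_contourCoeff_flatGF_sub_le
  refine ⟨3 * C + 32, fun n hn k => ?_⟩
  have hn0 : (0 : ℝ) < n := by exact_mod_cast hn
  have hw := walkCount_zero_pos n
  have hflat : ((flatSum n 0 (fun j => if j = k then (1 : ℝ) else 0) : ℝ) : ℂ)
      = contourCoeff n (flatGF k) := by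
    rw [flatSum_ofReal, flatSum_eq_contourCoeff]
    simp
  have hball : contourCoeff n (fun S => excursion S ^ k) = ((k / n * walkCount n k : ℝ) : ℂ) := by
    obtain ⟨m, rfl⟩ := Nat.exists_eq_add_of_le' hn
    have h := mul_contourCoeff_excursion_pow m k
    have hm : ((m : ℂ) + 1) ≠ 0 := by exact_mod_cast m.succ_ne_zero
    push_cast
    field_simp
    rw [mul_comm, h]
  have h1 := hC n hn k
  rw [← hflat, hball, ← Complex.ofReal_ofNat, ← Complex.ofReal_mul, ← Complex.ofReal_sub,
    Complex.norm_real, Real.norm_eq_abs] at h1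
  have h2 : |(uniform n).real {P | P.degSymm = k} - 2 * k / n * (walkCount n k / walkCount n 0)|
      ≤ 3 * C * ((n : ℝ)⁻¹ + k * (n : ℝ) ^ (-(3 / 2) : ℝ)) := by
    rw [uniform_real_degSymm]
    have e : flatSum n 0 (fun j => if j = k then (1 : ℝ) else 0) / walkCount n 0
        - 2 * k / n * (walkCount n k / walkCount n 0)
        = (flatSum n 0 (fun j => if j = k then (1 : ℝ) else 0) - 2 * (k / n * walkCount n k))
          / walkCount n 0 := by
      field_simp
    rw [e, abs_div, abs_of_pos hw]
    have e1 : Real.sqrt n * (n : ℝ) ^ (-(3 / 2) : ℝ) = (n : ℝ)⁻¹ := by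
      rw [Real.sqrt_eq_rpow, ← Real.rpow_add hn0, ← Real.rpow_neg_one]
      norm_num
    have e2 : Real.sqrt n * (n : ℝ) ^ (-2 : ℝ) = (n : ℝ) ^ (-(3 / 2) : ℝ) := by
      rw [Real.sqrt_eq_rpow, ← Real.rpow_add hn0]
      norm_num
    calc _ ≤ C * 4 ^ n * ((n : ℝ) ^ (-(3 / 2) : ℝ) + k * (n : ℝ) ^ (-2 : ℝ))
            / walkCount n 0 := by gcongr
      _ = C * ((n : ℝ) ^ (-(3 / 2) : ℝ) + k * (n : ℝ) ^ (-2 : ℝ))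
            * (4 ^ n / walkCount n 0) := by ring
      _ ≤ C * ((n : ℝ) ^ (-(3 / 2) : ℝ) + k * (n : ℝ) ^ (-2 : ℝ)) * (3 * Real.sqrt n) := by
          gcongr
          exact four_pow_div_walkCount_le hn
      _ = 3 * C * (Real.sqrt n * (n : ℝ) ^ (-(3 / 2) : ℝ)
            + k * (Real.sqrt n * (n : ℝ) ^ (-2 : ℝ))) := by ring
      _ = _ := by rw [e1, e2]
  have h3 := abs_walkCount_ratio_sub_exp_le hn k
  refine (abs_sub_le _ _ _).trans ((add_le_add h2 h3).trans ?_)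
  have h4 : 0 ≤ (n : ℝ) ^ (-(3 / 2) : ℝ) := by positivity
  have h5 : 0 ≤ (k : ℝ) * (n : ℝ) ^ (-(3 / 2) : ℝ) := by positivity
  nlinarith [mul_nonneg hC0 h4]

end GrandDyckPath

/-! ### From the local law to the limit law -/

theorem rayleighPDF_one_div_sqrt_two (x : ℝ) :
    rayleighPDF (1 / Real.sqrt 2) x = if 0 ≤ x then 2 * x * Real.exp (-x ^ 2) else 0 := by
  have h : (1 / Real.sqrt 2) ^ 2 = 1 / 2 := by
    rw [div_pow, Real.sq_sqrt (by norm_num), one_pow]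
  unfold rayleighPDF
  rw [h]
  congr 1
  norm_num
  ring

theorem lintegral_floor_mul_le (H : ℕ → ENNReal) {s : ℝ} (hs : 0 < s) :
    ∫⁻ x in Set.Ici (0 : ℝ), H ⌊x * s⌋₊ ≤ ∑' k, H k * ENNReal.ofReal (1 / s) := by
  have hcover : Set.Ici (0 : ℝ) ⊆ ⋃ k : ℕ, Set.Ico ((k : ℝ) / s) ((k + 1) / s) := by
    intro x hx
    have hx0 : 0 ≤ x * s := mul_nonneg hx hs.le
    rw [Set.mem_iUnion]
    refine ⟨⌊x * s⌋₊, ?_, ?_⟩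
    · rw [div_le_iff₀ hs]
      exact Nat.floor_le hx0
    · rw [lt_div_iff₀ hs]
      exact Nat.lt_floor_add_one _
  refine (lintegral_mono_set hcover).trans ((lintegral_iUnion_le _ _).trans ?_)
  refine ENNReal.tsum_le_tsum fun k => le_of_eq ?_
  have hfloor : Set.EqOn (fun x : ℝ => H ⌊x * s⌋₊) (fun _ => H k)
      (Set.Ico ((k : ℝ) / s) ((k + 1) / s)) := by
    rintro x ⟨h1, h2⟩
    rw [div_le_iff₀ hs] at h1
    rw [lt_div_iff₀ hs] at h2
    simp only
    rw [(Nat.floor_eq_iff (k.cast_nonneg.trans h1)).2 ⟨h1, h2⟩]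
  rw [setLIntegral_congr_fun measurableSet_Ico hfloor, setLIntegral_const, Real.volume_Ico]
  congr 2
  ring

namespace GrandDyckPath

/-- The probabilities of the single values, rescaled, converge to the Rayleigh density. -/
theorem tendsto_sqrt_mul_uniform_real_degSymm {x : ℝ} (hx : 0 ≤ x) :
    Tendsto (fun n : ℕ => Real.sqrt n *
        (uniform n).real {P : GrandDyckPath n | P.degSymm = ⌊x * Real.sqrt n⌋₊}) atTop
      (nhds (2 * x * Real.exp (-x ^ 2))) := by
  obtain ⟨C, hC⟩ := exists_abs_uniform_real_degSymm_sub_le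
  have hs : Tendsto (fun n : ℕ => Real.sqrt n) atTop atTop :=
    Real.tendsto_sqrt_atTop.comp tendsto_natCast_atTop_atTop
  have hr : Tendsto (fun n : ℕ => (⌊x * Real.sqrt n⌋₊ : ℝ) / Real.sqrt n) atTop (nhds x) :=
    (tendsto_nat_floor_mul_div_atTop hx).comp hs
  have hinv : Tendsto (fun n : ℕ => (Real.sqrt n)⁻¹) atTop (nhds 0) := tendsto_inv_atTop_zero.comp hs
  have hmain : Tendsto (fun n : ℕ => 2 * ((⌊x * Real.sqrt n⌋₊ : ℝ) / Real.sqrt n)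
      * Real.exp (-((⌊x * Real.sqrt n⌋₊ : ℝ) / Real.sqrt n) ^ 2)) atTop
      (nhds (2 * x * Real.exp (-x ^ 2))) :=
    (hr.const_mul 2).mul ((Real.continuous_exp.tendsto _).comp (hr.pow 2).neg)
  have herr : Tendsto (fun n : ℕ => C * ((⌊x * Real.sqrt n⌋₊ : ℝ) / Real.sqrt n * (Real.sqrt n)⁻¹
      + (Real.sqrt n)⁻¹ * (Real.sqrt n)⁻¹ + (Real.sqrt n)⁻¹)) atTop (nhds 0) := by
    simpa using (((hr.mul hinv).add (hinv.mul hinv)).add hinv).const_mul C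
  rw [← sub_zero (2 * x * Real.exp (-x ^ 2))]
  refine (hmain.sub (g := fun n : ℕ => 2 * ((⌊x * Real.sqrt n⌋₊ : ℝ) / Real.sqrt n)
      * Real.exp (-((⌊x * Real.sqrt n⌋₊ : ℝ) / Real.sqrt n) ^ 2) - Real.sqrt n *
        (uniform n).real {P : GrandDyckPath n | P.degSymm = ⌊x * Real.sqrt n⌋₊}) ?_).congr
    fun n => by ring
  refine squeeze_zero_norm' ?_ herr
  filter_upwards [eventually_ge_atTop 1] with n hn
  have hn0 : (0 : ℝ) < n := by exact_mod_cast hn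
  have hk := hC n hn ⌊x * Real.sqrt n⌋₊
  set k := ⌊x * Real.sqrt n⌋₊
  have hs0 : 0 < Real.sqrt n := Real.sqrt_pos.2 hn0
  have hsq : Real.sqrt n ^ 2 = n := Real.sq_sqrt hn0.le
  have e1 : Real.sqrt n * (n : ℝ) ^ (-(3 / 2) : ℝ) = (Real.sqrt n)⁻¹ * (Real.sqrt n)⁻¹ := by
    rw [Real.sqrt_eq_rpow, ← Real.rpow_add hn0, ← Real.rpow_neg hn0.le, ← Real.rpow_add hn0]
    norm_num
  have hinvn : (n : ℝ)⁻¹ = (Real.sqrt n)⁻¹ * (Real.sqrt n)⁻¹ := by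
    rw [← mul_inv, Real.mul_self_sqrt hn0.le]
  have e2 : Real.sqrt n * (n : ℝ)⁻¹ = (Real.sqrt n)⁻¹ := by
    rw [hinvn, mul_inv_cancel_left₀ hs0.ne']
  have e3 : 2 * ((k : ℝ) / Real.sqrt n) * Real.exp (-((k : ℝ) / Real.sqrt n) ^ 2)
      = Real.sqrt n * (2 * k / n * Real.exp (-(k : ℝ) ^ 2 / n)) := by
    rw [div_pow, hsq, ← neg_div]
    have : (k : ℝ) / Real.sqrt n = Real.sqrt n * (k / n) := by
      rw [div_eq_mul_inv, div_eq_mul_inv, hinvn]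
      field_simp
    rw [this]
    ring
  rw [e3, ← mul_sub, norm_mul, Real.norm_of_nonneg hs0.le, Real.norm_eq_abs, abs_sub_comm]
  refine (mul_le_mul_of_nonneg_left hk hs0.le).trans_eq ?_
  calc Real.sqrt n * (C * (((k : ℝ) + 1) * (n : ℝ) ^ (-(3 / 2) : ℝ) + (n : ℝ)⁻¹))
      = C * (((k : ℝ) + 1) * (Real.sqrt n * (n : ℝ) ^ (-(3 / 2) : ℝ))
          + Real.sqrt n * (n : ℝ)⁻¹) := by ring
    _ = _ := by
        rw [e1, e2]
        ring

/-- Fatou's lemma turns the convergence of densities into the portmanteau criterion. -/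
theorem rayleighMeasure_le_liminf {G : Set ℝ} (hG : IsOpen G) :
    rayleighMeasure (1 / Real.sqrt 2) G
      ≤ liminf (fun n : ℕ => uniform n {P | X n P / Real.sqrt n ∈ G}) atTop := by
  classical
  set H : ℕ → ℕ → ENNReal := fun n k => if (k : ℝ) / Real.sqrt n ∈ G then
    ENNReal.ofReal (Real.sqrt n * (uniform n).real {P : GrandDyckPath n | P.degSymm = k}) else 0
    with hH
  have hmeas (n : ℕ) : Measurable fun x : ℝ => H n ⌊x * Real.sqrt n⌋₊ :=
    (Measurable.of_discrete (f := H n)).comp (Nat.measurable_floor.comp (measurable_id.mul_const _))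
  have hbound : ∀ᶠ n : ℕ in atTop, ∫⁻ x in Set.Ici (0 : ℝ), H n ⌊x * Real.sqrt n⌋₊
      ≤ uniform n {P | X n P / Real.sqrt n ∈ G} := by
    filter_upwards [eventually_ge_atTop 1] with n hn
    have hs0 : 0 < Real.sqrt n := Real.sqrt_pos.2 (by exact_mod_cast hn)
    refine (lintegral_floor_mul_le (H n) hs0).trans ?_
    have hset : {P : GrandDyckPath n | X n P / Real.sqrt n ∈ G}
        = ⋃ k : ℕ, {P : GrandDyckPath n | P.degSymm = k ∧ (k : ℝ) / Real.sqrt n ∈ G} := by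
      ext P
      simp [X]
    rw [hset, measure_iUnion]
    · refine ENNReal.tsum_le_tsum fun k => ?_
      by_cases hk : (k : ℝ) / Real.sqrt n ∈ G
      · simp only [hH, hk, if_true, and_true]
        rw [← ENNReal.ofReal_mul (by positivity)]
        have e : Real.sqrt n * (uniform n).real {P : GrandDyckPath n | P.degSymm = k}
            * (1 / Real.sqrt n) = (uniform n).real {P : GrandDyckPath n | P.degSymm = k} := by
          field_simp
        rw [e, ofReal_measureReal]
      · simp [hH, hk]
    · intro i j hij
      rw [Function.onFun, Set.disjoint_left]
      rintro P ⟨h1, -⟩ ⟨h2, -⟩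
      exact hij (h1.symm.trans h2)
    · exact fun k => MeasurableSpace.measurableSet_top
  refine le_trans ?_ (liminf_le_liminf hbound)
  refine le_trans ?_ (lintegral_liminf_le hmeas)
  rw [rayleighMeasure, withDensity_apply _ hG.measurableSet,
    ← lintegral_indicator hG.measurableSet, ← lintegral_indicator measurableSet_Ici]
  refine lintegral_mono fun x => ?_
  by_cases hxG : x ∈ G
  swap
  · simp [hxG]
  by_cases hx : 0 ≤ x
  swap
  · simp [hxG, rayleighPDF, hx]
  rw [Set.indicator_of_mem hxG, Set.indicator_of_mem (Set.mem_Ici.2 hx),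
    rayleighPDF_one_div_sqrt_two, if_pos hx]
  have hs : Tendsto (fun n : ℕ => Real.sqrt n) atTop atTop :=
    Real.tendsto_sqrt_atTop.comp tendsto_natCast_atTop_atTop
  have hr : Tendsto (fun n : ℕ => (⌊x * Real.sqrt n⌋₊ : ℝ) / Real.sqrt n) atTop (nhds x) :=
    (tendsto_nat_floor_mul_div_atTop hx).comp hs
  have hlim := ENNReal.tendsto_ofReal (tendsto_sqrt_mul_uniform_real_degSymm hx)
  refine (Tendsto.liminf_eq (hlim.congr' ?_)).ge
  filter_upwards [hr.eventually_mem (hG.mem_nhds hxG)] with n hn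
  rw [hH]
  simp only [hn, if_true]

theorem tendstoInDistribution_X :
    TendstoInDistribution (fun (n : ℕ) (P : GrandDyckPath n) => X n P / Real.sqrt n) atTop
      (fun x : ℝ => x) uniform (rayleighMeasure (1 / Real.sqrt 2)) where
  forall_aemeasurable n := Measurable.of_discrete.aemeasurable
  aemeasurable_limit := aemeasurable_id
  tendsto := by
    refine tendsto_of_forall_isOpen_le_liminf' fun G hG => ?_
    simp only [ProbabilityMeasure.coe_mk]
    rw [Measure.map_id']
    refine (rayleighMeasure_le_liminf hG).trans_eq ?_
    congr 1
    funext n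
    rw [Measure.map_apply Measurable.of_discrete hG.measurableSet]
    rfl

/-! ### Mean and variance -/

theorem integral_X_eq {n : ℕ} (hn : 1 ≤ n) :
    ∫ P, X n P ∂(uniform n) = 4 ^ n / walkCount n 0 / 2 := by
  obtain ⟨m, rfl⟩ := Nat.exists_eq_add_of_le' hn
  rw [integral_X, pow_succ]
  ring

theorem variance_X_eq {n : ℕ} (hn : 1 ≤ n) :
    variance (X n) (uniform n) = 2 * (n : ℝ) * ((n : ℝ) - 1) / (2 * (n : ℝ) - 1)
      + 4 ^ n / walkCount n 0 / 2 - (4 ^ n / walkCount n 0 / 2) ^ 2 := by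
  obtain ⟨m, rfl⟩ := Nat.exists_eq_add_of_le' hn
  rw [variance_X, pow_succ (4 : ℝ) m]
  push_cast
  ring_nf

theorem sqrt_pi_mul_le (n : ℕ) : Real.sqrt (Real.pi * n) ≤ 4 ^ n / walkCount n 0 := by
  rw [Real.sqrt_le_left (div_nonneg (by positivity) (walkCount_nonneg _ _))]
  exact pi_mul_le_sq n

theorem le_sqrt_pi_mul_add (n : ℕ) :
    4 ^ n / walkCount n 0 ≤ Real.sqrt (Real.pi * n) + 2 := by
  have h0 := Real.sqrt_nonneg (Real.pi * n)
  have h1 : Real.sqrt (Real.pi * n) ^ 2 = Real.pi * n := Real.sq_sqrt (by positivity)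
  refine le_of_sq_le_sq ((sq_le_pi_mul n).trans ?_) (by positivity)
  nlinarith [Real.pi_le_four]

theorem isBigO_integral_X :
    (fun n : ℕ => (∫ P, X n P ∂(uniform n)) - Real.sqrt (Real.pi * n) / 2)
      =O[atTop] (fun _ : ℕ => (1 : ℝ)) := by
  refine IsBigO.of_bound 1 ?_
  filter_upwards [eventually_ge_atTop 1] with n hn
  rw [integral_X_eq hn, Real.norm_eq_abs, norm_one, abs_le]
  constructor <;> linarith [sqrt_pi_mul_le n, le_sqrt_pi_mul_add n]

theorem isBigO_variance_X :
    (fun n : ℕ => variance (X n) (uniform n) - (1 - Real.pi / 4) * n)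
      =O[atTop] (fun n : ℕ => Real.sqrt n) := by
  refine IsBigO.of_bound 4 ?_
  filter_upwards [eventually_ge_atTop 1] with n hn
  have hn1 : (1 : ℝ) ≤ n := by exact_mod_cast hn
  have hs : 1 ≤ Real.sqrt n := Real.one_le_sqrt.2 hn1
  have h1 := pi_mul_le_sq n
  have h2 := sq_le_pi_mul n
  have h3 := four_pow_div_walkCount_le hn
  have h4 : 0 ≤ 4 ^ n / walkCount n 0 := div_nonneg (by positivity) (walkCount_nonneg _ _)
  have h5 : 2 * (n : ℝ) * ((n : ℝ) - 1) / (2 * (n : ℝ) - 1) = n - n / (2 * n - 1) := by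
    have : (2 * n - 1 : ℝ) ≠ 0 := by linarith
    field_simp
    ring
  have h6 : (n : ℝ) / (2 * n - 1) ≤ 1 := by
    rw [div_le_one (by linarith)]
    linarith
  have h7 : 0 ≤ (n : ℝ) / (2 * n - 1) := div_nonneg (by linarith) (by linarith)
  rw [variance_X_eq hn, h5, Real.norm_eq_abs, Real.norm_of_nonneg (Real.sqrt_nonneg _), abs_le]
  have := Real.pi_le_four
  constructor <;> nlinarith

end GrandDyckPath

theorem four_pow_div_two {n : ℕ} (hn : 1 ≤ n) :
    4 ^ n / walkCount n 0 / 2 = 2 ^ (2 * n - 1) / walkCount n 0 := by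
  obtain ⟨m, rfl⟩ := Nat.exists_eq_add_of_le' hn
  rw [show 2 * (m + 1) - 1 = 2 * m + 1 by omega, pow_succ, pow_succ, pow_mul]
  ring

theorem mainTheorem6 :
    -- Rayleigh limit law
    TendstoInDistribution
      (fun (n : ℕ) (P : GrandDyckPath n) => GrandDyckPath.X n P / Real.sqrt n) atTop
      (fun x : ℝ => x) GrandDyckPath.uniform (rayleighMeasure (1 / Real.sqrt 2)) ∧
    -- the density of the limit law
    rayleighMeasure (1 / Real.sqrt 2) = volume.withDensity
      (fun x : ℝ => ENNReal.ofReal (if 0 ≤ x then 2 * x * Real.exp (-x ^ 2) else 0)) ∧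
    -- asymptotics of mean and variance
    ((fun n : ℕ => (∫ P, GrandDyckPath.X n P ∂(GrandDyckPath.uniform n))
        - Real.sqrt (Real.pi * n) / 2) =O[atTop] (fun _ : ℕ => (1 : ℝ))) ∧
    ((fun n : ℕ => variance (GrandDyckPath.X n) (GrandDyckPath.uniform n)
        - (1 - Real.pi / 4) * n) =O[atTop] (fun n : ℕ => Real.sqrt n)) ∧
    -- local law, uniformly in `k`
    (∃ C : ℝ, ∀ n : ℕ, 1 ≤ n → ∀ k : ℕ,
      |(GrandDyckPath.uniform n).real {P | P.degSymm = k}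
          - 2 * k / n * Real.exp (-(k : ℝ) ^ 2 / n)|
        ≤ C * (((k : ℝ) + 1) * (n : ℝ) ^ (-(3 / 2) : ℝ) + (n : ℝ)⁻¹)) ∧
    -- exact mean and variance
    (∀ n : ℕ, 1 ≤ n →
      (∫ P, GrandDyckPath.X n P ∂(GrandDyckPath.uniform n))
        = 2 ^ (2 * n - 1) / ((2 * n).choose n : ℝ)) ∧
    (∀ n : ℕ, 1 ≤ n →
      variance (GrandDyckPath.X n) (GrandDyckPath.uniform n)
        = 2 * (n : ℝ) * ((n : ℝ) - 1) / (2 * (n : ℝ) - 1)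
          + 2 ^ (2 * n - 1) / ((2 * n).choose n : ℝ)
          - 4 ^ (2 * n - 1) / ((2 * n).choose n : ℝ) ^ 2) := by
  refine ⟨GrandDyckPath.tendstoInDistribution_X, ?_, GrandDyckPath.isBigO_integral_X,
    GrandDyckPath.isBigO_variance_X, GrandDyckPath.exists_abs_uniform_real_degSymm_sub_le, ?_, ?_⟩
  · unfold rayleighMeasure
    simp only [rayleighPDF_one_div_sqrt_two]
  · intro n hn
    rw [GrandDyckPath.integral_X_eq hn, four_pow_div_two hn]
    simp [walkCount]
  · intro n hn
    rw [GrandDyckPath.variance_X_eq hn, four_pow_div_two hn, div_pow, ← pow_mul, mul_comm _ 2,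
      pow_mul 2 2]
    norm_num [walkCount]
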